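/- Let $n$ parties each hold a system $\mathbb{C}^d$, and let $|\psi\rangle\in(\mathbb{C}^d)^{\otimes n}$ be a fully entangled state, i.e. $\psi\neq 0$ and each of its single-party reduced density matrices has rank $d$. Regard $|\psi\rangle\otimes|\psi\rangle$ as an $n$-partite state in which party $i$ holds its subsystems of both copies (local space $\mathbb{C}^d\otimes\mathbb{C}^d$), let $\mathrm{SWAP}$ be the local operator that exchanges the two copies, and suppose that the stabilizer of $|\psi\rangle^{\otimes 2}$ is trivial: $$\mathcal{S}_{\psi^{\otimes 2}}=\Big\{S=\bigotimes_{i=1}^n S^{(i)} : S^{(i)}\in \mathrm{GL}(d^2,\mathbb{C}),\ S|\psi\rangle^{\otimes 2}=|\psi\rangle^{\otimes 2}\Big\}=\{\mathbb{1},\mathrm{SWAP}\}.$$ Let $g_1,g_2,h_1,h_2$ be local invertible operators, i.e. of the form $\bigotimes_{i=1}^n A^{(i)}$ with $A^{(i)}\in\mathrm{GL}(d,\mathbb{C})$. Vectors are understood to represent the corresponding normalized states (up to a phase). 1. If $g_1|\psi\rangle\otimes g_2|\psi\rangle$ can be transformed deterministically into $h_1|\psi\rangle\otimes h_2|\psi\rangle$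 by $\mathrm{LOCC}_{\mathbb{N}}$, i.e. by local operations and classical communication of the $n$ parties in a finite number of rounds, then the transformation is trivial: it is a local unitary transformation of the two states separately, possibly combined with an exchange of the two states. That is, either $g_1|\psi\rangle$ is local-unitarily equivalent to $h_1|\psi\rangle$ and $g_2|\psi\rangle$ to $h_2|\psi\rangle$, or $g_1|\psi\rangle$ is local-unitarily equivalent to $h_2|\psi\rangle$ and $g_2|\psi\rangle$ to $h_1|\psi\rangle$. 2. If the two final states are identical, $h_1|\psi\rangle=h_2|\psi\rangle$ (in particular if $h_1=h_2$), then the same conclusion holds if the transformation is possible by LOCC, where the protocol may have infinitely many rounds, the implemented map being the limit of the maps obtained by stopping one and the same protocol after more and more rounds. -/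

import Mathlib

open Filter Topology Matrix

namespace MultiLOCC

/-! ### Multipartite vectors and local operators

A party with index type `α i` holds the space `ℂ^(α i)`; the joint space `⨂ i, ℂ^(α i)` is written in
the product basis, so a vector is a function `(∀ i, α i) → ℂ`. -/

/-- The product operator `⨂ i, A i`, in the product bases. -/
def localOp {n : ℕ} {α β : Fin n → Type} (A : ∀ i, Matrix (β i) (α i) ℂ) :
    Matrix (∀ i, β i) (∀ i, α i) ℂ :=
  Matrix.of fun y x => ∏ i, A i (y i) (x i)

/-- The action of the local invertible operator `⨂ i, g i` on a vector. -/
noncomputable def act {n d : ℕ} (g : Fin n → GL (Fin d) ℂ) (ψ : (Fin n → Fin d) → ℂ) :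
    (Fin n → Fin d) → ℂ :=
  localOp (fun i => (g i : Matrix (Fin d) (Fin d) ℂ)) *ᵥ ψ

/-- The normalized density matrix `|ψ⟩⟨ψ| / ⟨ψ|ψ⟩` of a nonzero vector `ψ`. -/
noncomputable def stateOf {ι : Type} [Fintype ι] (ψ : ι → ℂ) : Matrix ι ι ℂ :=
  (star ψ ⬝ᵥ ψ)⁻¹ • Matrix.vecMulVec ψ (star ψ)

/-- The reduced density matrix of party `i` (up to normalization of `ψ`): all other parties are
traced out. -/
noncomputable def reducedDensity {n d : ℕ} (ψ : (Fin n → Fin d) → ℂ) (i : Fin n) :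
    Matrix (Fin d) (Fin d) ℂ :=
  Matrix.of fun a b => ∑ x : Fin n → Fin d with x i = a, ψ x * star (ψ (Function.update x i b))

/-- All single-party reduced density matrices have full rank. -/
def FullyEntangled {n d : ℕ} (ψ : (Fin n → Fin d) → ℂ) : Prop :=
  ∀ i, (reducedDensity ψ i).rank = d

/-- The set of local invertible operators that leave `ψ` invariant. -/
def stabilizer {n : ℕ} {α : Type} [Fintype α] [DecidableEq α] (ψ : (Fin n → α) → ℂ) :
    Set (Matrix (Fin n → α) (Fin n → α) ℂ) :=
  {S | (∃ A : Fin n → GL α ℂ, S = localOp fun i => (A i : Matrix α α ℂ)) ∧ S *ᵥ ψ = ψ}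

/-- The vector `a ⊗ b`, shared among the same `n` parties: party `i` holds its subsystem of `a` and its
subsystem of `b`, so that its local space is `ℂ^d ⊗ ℂ^d`. -/
def pair {n d : ℕ} (a b : (Fin n → Fin d) → ℂ) : (Fin n → Fin d × Fin d) → ℂ :=
  fun x => a (fun i => (x i).1) * b (fun i => (x i).2)

/-- The operator that exchanges the two copies: every party applies the flip of `ℂ^d ⊗ ℂ^d`. -/
def swapOp (n d : ℕ) : Matrix (Fin n → Fin d × Fin d) (Fin n → Fin d × Fin d) ℂ :=
  localOp fun _ => Matrix.of fun y x => if y = x.swap then 1 else 0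

/-- `a` and `b` represent states that are related by a local unitary `⨂ i, u i`. -/
def LUEquivalent {n d : ℕ} (a b : (Fin n → Fin d) → ℂ) : Prop :=
  ∃ u : Fin n → Matrix.unitaryGroup (Fin d) ℂ,
    stateOf (localOp (fun i => (u i : Matrix (Fin d) (Fin d) ℂ)) *ᵥ a) = stateOf b

/-- The transformation `a₁ ⊗ a₂ → b₁ ⊗ b₂` is achieved by local unitaries on the two states
separately, possibly combined with exchanging the two states. -/
def TrivialTransformation {n d : ℕ} (a₁ a₂ b₁ b₂ : (Fin n → Fin d) → ℂ) : Prop :=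
  (LUEquivalent a₁ b₁ ∧ LUEquivalent a₂ b₂) ∨ (LUEquivalent a₁ b₂ ∧ LUEquivalent a₂ b₁)

/-! ### Completely positive maps and LOCC -/

/-- Linear maps from operators on `ℂ^ι` to operators on `ℂ^κ`. -/
abbrev OpMap (ι κ : Type) : Type := Matrix ι ι ℂ →ₗ[ℂ] Matrix κ κ ℂ

/-- Complete positivity, in Kraus form. -/
def IsCP {ι κ : Type} [Fintype ι] (Φ : OpMap ι κ) : Prop :=
  ∃ (r : ℕ) (K : Fin r → Matrix κ ι ℂ), ∀ X, Φ X = ∑ l, K l * X * (K l)ᴴ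

/-- Preservation of the trace. -/
def IsTP {ι κ : Type} [Fintype ι] [Fintype κ] (Φ : OpMap ι κ) : Prop :=
  ∀ X, (Φ X).trace = X.trace

/-- `E` is the tensor product map `⨂ i, Φ i`; since product operators span, this determines `E`. -/
def IsTensor {n : ℕ} {α β : Fin n → Type} (E : OpMap (∀ i, α i) (∀ i, β i))
    (Φ : ∀ i, OpMap (α i) (β i)) : Prop :=
  ∀ X : ∀ i, Matrix (α i) (α i) ℂ, E (localOp X) = localOp fun i => Φ i (X i)

/-- A one-round protocol led by party `k`. The family `J` is a quantum instrument with outcomes in `ℕ`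
(finitely many outcomes: all but finitely many members vanish): party `k` performs a measurement, given
by completely positive maps `Φ m k` whose sum is trace preserving, and broadcasts the outcome `m`; then
every other party `i` applies a channel `Φ m i` that may depend on `m`. Local dimensions may change, so
that ancillas and local memories are allowed. -/
def IsOneWayLocal {n : ℕ} {α β : Fin n → Type} [∀ i, Fintype (α i)] [∀ i, Fintype (β i)]
    (k : Fin n) (J : ℕ → OpMap (∀ i, α i) (∀ i, β i)) : Prop :=
  ∃ Φ : ℕ → ∀ i, OpMap (α i) (β i),
    (∀ m i, IsCP (Φ m i)) ∧
    (∀ m i, i ≠ k → IsTP (Φ m i)) ∧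
    (∀ X, HasSum (fun m => (Φ m k X).trace) X.trace) ∧
    ∀ m, IsTensor (J m) (Φ m)

/-- The instrument `J'` continues `J` by one more round: after outcome `j` of `J` some party (which may
depend on `j`) leads a one-round protocol `F j`, and then the outcomes `(j, m)` may be coarse-grained,
by means of `f`. -/
def IsLinked {n : ℕ} {α β γ : Fin n → Type}
    [∀ i, Fintype (β i)] [∀ i, Fintype (γ i)]
    (J : ℕ → OpMap (∀ i, α i) (∀ i, β i)) (J' : ℕ → OpMap (∀ i, α i) (∀ i, γ i)) : Prop :=
  ∃ (F : ℕ → ℕ → OpMap (∀ i, β i) (∀ i, γ i)) (f : ℕ × ℕ → ℕ),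
    (∀ j, ∃ k, IsOneWayLocal k (F j)) ∧
    ∀ l X, HasSum (fun p : {p : ℕ × ℕ // f p = l} => F p.1.1 p.1.2 (J p.1.1 X)) (J' l X)

/-- Instruments that are implemented by local operations and classical communication in a finite number
of rounds. -/
inductive IsFiniteLOCC {n : ℕ} {α : Fin n → Type} [∀ i, Fintype (α i)] :
    ∀ {β : Fin n → Type} [∀ i, Fintype (β i)], (ℕ → OpMap (∀ i, α i) (∀ i, β i)) → Prop
  | one {β : Fin n → Type} [∀ i, Fintype (β i)] (k : Fin n)
      (J : ℕ → OpMap (∀ i, α i) (∀ i, β i)) (h : IsOneWayLocal k J) : IsFiniteLOCC J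
  | next {β γ : Fin n → Type} [∀ i, Fintype (β i)] [∀ i, Fintype (γ i)]
      (J : ℕ → OpMap (∀ i, α i) (∀ i, β i)) (J' : ℕ → OpMap (∀ i, α i) (∀ i, γ i))
      (h : IsFiniteLOCC J) (hlink : IsLinked J J') : IsFiniteLOCC J'

/-- The map `Λ` arises from the instrument `J` by stopping: given outcome `j`, each party `i` applies a
channel `R j i` (the identity, or discarding its memory) to produce its output system, and the outcome
is forgotten. -/
def IsReadout {n : ℕ} {α β γ : Fin n → Type}
    [∀ i, Fintype (β i)] [∀ i, Fintype (γ i)]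
    (J : ℕ → OpMap (∀ i, α i) (∀ i, β i)) (Λ : OpMap (∀ i, α i) (∀ i, γ i)) : Prop :=
  ∃ (R : ℕ → ∀ i, OpMap (β i) (γ i)) (E : ℕ → OpMap (∀ i, β i) (∀ i, γ i)),
    (∀ j i, IsCP (R j i) ∧ IsTP (R j i)) ∧
    (∀ j, IsTensor (E j) (R j)) ∧
    ∀ X, HasSum (fun j => E j (J j X)) (Λ X)

/-- The class LOCC_ℕ: maps implemented by a protocol with a finite number of rounds. -/
def IsLOCCN {n : ℕ} {α γ : Fin n → Type} [∀ i, Fintype (α i)] [∀ i, Fintype (γ i)]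
    (Λ : OpMap (∀ i, α i) (∀ i, γ i)) : Prop :=
  ∃ J : ℕ → OpMap (∀ i, α i) (∀ i, γ i), IsFiniteLOCC J ∧ ∀ X, HasSum (fun j => J j X) (Λ X)

/-- The class LOCC, with a possibly infinite number of rounds: `Λ` is the limit of what is implemented
when one and the same protocol, given by instruments `J 0, J 1, …` each of which continues the previous
one by a round, is stopped after more and more rounds. -/
def IsLOCC {n : ℕ} {α γ : Fin n → Type} [∀ i, Fintype (α i)] [∀ i, Fintype (γ i)]
    (Λ : OpMap (∀ i, α i) (∀ i, γ i)) : Prop :=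
  ∃ (D : ℕ → Fin n → ℕ) (J : ∀ s, ℕ → OpMap (∀ i, α i) (∀ i, Fin (D s i)))
    (L : ℕ → OpMap (∀ i, α i) (∀ i, γ i)),
    IsFiniteLOCC (J 0) ∧
    (∀ s, IsLinked (J s) (J (s + 1))) ∧
    (∀ s, IsReadout (J s) (L s)) ∧
    ∀ X, Tendsto (fun s => L s X) atTop (𝓝 (Λ X))

/-- The (normalized) state of `a` can be transformed deterministically into that of `b` by a finite-round
LOCC protocol. -/
def TransformsLOCCN {n : ℕ} {α : Type} [Fintype α] (a b : (Fin n → α) → ℂ) : Prop :=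
  ∃ Λ : OpMap (Fin n → α) (Fin n → α),
    IsLOCCN (α := fun _ => α) (γ := fun _ => α) Λ ∧ Λ (stateOf a) = stateOf b

/-- The (normalized) state of `a` can be transformed deterministically into that of `b` by LOCC. -/
def TransformsLOCC {n : ℕ} {α : Type} [Fintype α] (a b : (Fin n → α) → ℂ) : Prop :=
  ∃ Λ : OpMap (Fin n → α) (Fin n → α),
    IsLOCC (α := fun _ => α) (γ := fun _ => α) Λ ∧ Λ (stateOf a) = stateOf b

end MultiLOCC

open MultiLOCC

namespace MultiLOCC

/-! ### The algebra of product operators -/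

section LocalOp

variable {n : ℕ} {α β γ : Fin n → Type}

/-! Only two features of LOCC enter. An LOCC map, with finitely or infinitely many rounds, is a
pointwise limit of sums of maps `X ↦ K X Kᴴ` with product `K`, and it preserves the trace of pure
states. Compactness of the normalized product operators turns such a limit into a finite sum of the
same kind (`exists_kraus_of_mem_closedSepCone`), and trace preservation gives `∑ Kᴴ K = 1`.

Write `G = g₁ ⊗ g₂`, `H = h₁ ⊗ h₂`. The output is pure, so each `K` sends `G(ψ ⊗ ψ)` to a multiple
of `H(ψ ⊗ ψ)`. If the multiple is a nonzero `c`, then `H⁻¹KG` is a product operator with eigenvector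
`ψ ⊗ ψ`, and the trivial stabilizer forces `KG = c H S` with `S` the identity or the swap
(`localOp_eq_smul_of_mulVec_pair`). Applying `Gᴴ ∑ Kᴴ K = Gᴴ` to `G(ψ ⊗ ψ)` then puts `g₁ᴴg₁ψ ⊗
g₂ᴴg₂ψ` into the span of `x ⊗ y` and `y ⊗ x`, where `x = h₁ᴴh₁ψ` and `y = h₂ᴴh₂ψ`. Comparing 2×2
minors, a product vector in this span is, up to scaling, one of the two spanning vectors
(`isProportional_of_mul_eq_add`).

It remains to see that `gᴴgψ ∝ hᴴhψ` makes `gψ` and `hψ` local-unitarily equivalent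
(`luEquivalent_of_isProportional`). Here `ψ` is an eigenvector of `T = (gᴴg)⁻¹hᴴh`, so `T ⊗ T⁻¹`
stabilizes `ψ ⊗ ψ` and `T` must be scalar. Hence `hg⁻¹` is a local unitary up to scale, and it maps
`gψ` to `hψ`. -/

@[simp]
theorem localOp_apply (A : ∀ i, Matrix (β i) (α i) ℂ) (y : ∀ i, β i) (x : ∀ i, α i) :
    localOp A y x = ∏ i, A i (y i) (x i) := rfl

theorem localOp_mul [∀ i, Fintype (β i)] (A : ∀ i, Matrix (γ i) (β i) ℂ)
    (B : ∀ i, Matrix (β i) (α i) ℂ) :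
    localOp A * localOp B = localOp fun i => A i * B i := by
  ext y x
  simp only [Matrix.mul_apply, localOp_apply, ← Finset.prod_mul_distrib]
  rw [Finset.prod_univ_sum, Fintype.piFinset_univ]

theorem localOp_conjTranspose (A : ∀ i, Matrix (β i) (α i) ℂ) :
    (localOp A)ᴴ = localOp fun i => (A i)ᴴ := by
  ext y x
  simp [Matrix.conjTranspose_apply]

theorem localOp_one [∀ i, DecidableEq (α i)] :
    localOp (fun i => (1 : Matrix (α i) (α i) ℂ)) = 1 := by
  ext y x
  simp only [localOp_apply, Matrix.one_apply]
  by_cases h : y = x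
  · subst h; simp
  · obtain ⟨i, hi⟩ := Function.ne_iff.mp h
    rw [if_neg h]
    exact Finset.prod_eq_zero (Finset.mem_univ i) (if_neg hi)

theorem localOp_smul (c : Fin n → ℂ) (A : ∀ i, Matrix (β i) (α i) ℂ) :
    localOp (fun i => c i • A i) = (∏ i, c i) • localOp A := by
  ext y x
  simp [Finset.prod_mul_distrib]

theorem localOp_eq_zero {A : ∀ i, Matrix (β i) (α i) ℂ} {i : Fin n} (h : A i = 0) :
    localOp A = 0 := by
  ext y x
  exact Finset.prod_eq_zero (Finset.mem_univ i) (by simp [h])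

theorem localOp_sum {L : Fin n → Type} [∀ i, Fintype (L i)]
    (A : ∀ i, L i → Matrix (β i) (α i) ℂ) :
    localOp (fun i => ∑ l, A i l) = ∑ l : ∀ i, L i, localOp fun i => A i (l i) := by
  ext y x
  simp only [localOp_apply, Matrix.sum_apply]
  rw [Finset.prod_univ_sum, Fintype.piFinset_univ]

theorem localOp_single [∀ i, DecidableEq (α i)] [∀ i, DecidableEq (β i)]
    (y : ∀ i, β i) (x : ∀ i, α i) :
    localOp (fun i => Matrix.single (y i) (x i) (1 : ℂ)) = Matrix.single y x 1 := by
  ext b a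
  simp only [localOp_apply, Matrix.single_apply]
  by_cases h : y = b ∧ x = a
  · obtain ⟨rfl, rfl⟩ := h; simp
  · rw [if_neg h]
    have : ∃ i, ¬ (y i = b i ∧ x i = a i) := by
      by_contra! hc
      exact h ⟨funext fun i => (hc i).1, funext fun i => (hc i).2⟩
    obtain ⟨i, hi⟩ := this
    exact Finset.prod_eq_zero (Finset.mem_univ i) (if_neg hi)

theorem trace_localOp [∀ i, Fintype (α i)] (A : ∀ i, Matrix (α i) (α i) ℂ) :
    (localOp A).trace = ∏ i, (A i).trace := by
  simp only [Matrix.trace, Matrix.diag_apply, localOp_apply]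
  rw [Finset.prod_univ_sum, Fintype.piFinset_univ]

/-- Additive homogeneous properties of operators follow from the case of product operators. -/
theorem localOp_induction [∀ i, Fintype (α i)] [∀ i, Fintype (β i)]
    {P : Matrix (∀ i, β i) (∀ i, α i) ℂ → Prop}
    (hadd : ∀ X Y, P X → P Y → P (X + Y)) (hsmul : ∀ (c : ℂ) X, P X → P (c • X))
    (hzero : P 0) (hloc : ∀ A, P (localOp A)) (X) : P X := by
  classical
  rw [Matrix.matrix_eq_sum_single X]
  have hsum : ∀ {ι : Type} (s : Finset ι) (F : ι → Matrix (∀ i, β i) (∀ i, α i) ℂ),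
      (∀ i, P (F i)) → P (∑ i ∈ s, F i) := by
    intro ι s F hF
    induction s using Finset.induction_on with
    | empty => simpa using hzero
    | insert a s ha ih => rw [Finset.sum_insert ha]; exact hadd _ _ (hF a) ih
  refine hsum _ _ fun y => hsum _ _ fun x => ?_
  have : Matrix.single y x (X y x) = X y x • localOp fun i => Matrix.single (y i) (x i) (1 : ℂ) := by
    rw [localOp_single, Matrix.smul_single, smul_eq_mul, mul_one]
  rw [this]
  exact hsmul _ _ (hloc _)

end LocalOp

/-! ### The cone of separable maps -/

section SepCone

variable {n : ℕ} {α β γ : Fin n → Type} [∀ i, Fintype (α i)]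

/-- The completely positive map with the single Kraus operator `M`. -/
noncomputable def conjMap {ι κ : Type} [Fintype ι] (M : Matrix κ ι ℂ) (X : Matrix ι ι ℂ) : Matrix κ κ ℂ :=
  M * X * Mᴴ

/-- The finite sums of completely positive maps with a product Kraus operator. -/
noncomputable def sepCone (α β : Fin n → Type) [∀ i, Fintype (α i)] :
    AddSubmonoid (Matrix (∀ i, α i) (∀ i, α i) ℂ → Matrix (∀ i, β i) (∀ i, β i) ℂ) :=
  AddSubmonoid.closure (Set.range fun K : ∀ i, Matrix (β i) (α i) ℂ => conjMap (localOp K))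

/-- The closure of the cone of separable maps, in the topology of pointwise convergence. -/
noncomputable def closedSepCone (α β : Fin n → Type) [∀ i, Fintype (α i)] :
    AddSubmonoid (Matrix (∀ i, α i) (∀ i, α i) ℂ → Matrix (∀ i, β i) (∀ i, β i) ℂ) :=
  (sepCone α β).topologicalClosure

theorem sepCone_le_closedSepCone : sepCone α β ≤ closedSepCone α β :=
  AddSubmonoid.le_topologicalClosure _

theorem conjMap_comp {ι κ μ : Type} [Fintype ι] [Fintype κ] (M : Matrix μ κ ℂ)
    (N : Matrix κ ι ℂ) (X : Matrix ι ι ℂ) : conjMap M (conjMap N X) = conjMap (M * N) X := by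
  simp only [conjMap, Matrix.conjTranspose_mul, Matrix.mul_assoc]

theorem continuous_conjMap {ι κ : Type} [Fintype ι] (M : Matrix κ ι ℂ) :
    Continuous (conjMap M) := by
  unfold conjMap
  fun_prop

theorem sepCone_properties {F : Matrix (∀ i, α i) (∀ i, α i) ℂ → Matrix (∀ i, β i) (∀ i, β i) ℂ}
    (hF : F ∈ sepCone α β) : Continuous F ∧ ∀ X Y, F (X + Y) = F X + F Y := by
  refine AddSubmonoid.closure_induction (motive := fun F _ => Continuous F ∧ ∀ X Y, F (X + Y) = F X + F Y)
    ?_ ?_ ?_ hF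
  · rintro _ ⟨K, rfl⟩
    exact ⟨continuous_conjMap _, fun X Y => by simp [conjMap, Matrix.mul_add, Matrix.add_mul]⟩
  · exact ⟨continuous_const, fun X Y => by simp⟩
  · rintro F G - - ⟨hF, hF'⟩ ⟨hG, hG'⟩
    refine ⟨hF.add hG, fun X Y => ?_⟩
    simp only [Pi.add_apply, hF', hG']
    abel

theorem sepCone_comp [∀ i, Fintype (β i)]
    {F : Matrix (∀ i, β i) (∀ i, β i) ℂ → Matrix (∀ i, γ i) (∀ i, γ i) ℂ}
    {G : Matrix (∀ i, α i) (∀ i, α i) ℂ → Matrix (∀ i, β i) (∀ i, β i) ℂ}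
    (hF : F ∈ sepCone β γ) (hG : G ∈ sepCone α β) : F ∘ G ∈ sepCone α γ := by
  have hFadd := (sepCone_properties hF).2
  refine AddSubmonoid.closure_induction (motive := fun F _ => F ∘ G ∈ sepCone α γ) ?_ ?_ ?_ hF
  · rintro _ ⟨K, rfl⟩
    refine AddSubmonoid.closure_induction
      (motive := fun G _ => (conjMap (localOp K)) ∘ G ∈ sepCone α γ) ?_ ?_ ?_ hG
    · rintro _ ⟨K', rfl⟩
      refine AddSubmonoid.subset_closure ⟨fun i => K i * K' i, ?_⟩
      funext X
      simp only [Function.comp, conjMap_comp, localOp_mul]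
    · convert (sepCone α γ).zero_mem using 1
      funext X
      simp [conjMap]
    · intro G G' _ _ h h'
      convert (sepCone α γ).add_mem h h' using 1
      funext X
      simp [conjMap, Matrix.mul_add, Matrix.add_mul]
  · exact (sepCone α γ).zero_mem
  · intro F F' _ _ h h'
    exact (sepCone α γ).add_mem h h'

/-- Only the inner map ranges over the closure: composing with a fixed continuous map on the left is
continuous for pointwise convergence. This is enough, since the step added to a protocol by one
round or a readout is itself a finite sum. -/
theorem closedSepCone_comp [∀ i, Fintype (β i)]
    {F : Matrix (∀ i, β i) (∀ i, β i) ℂ → Matrix (∀ i, γ i) (∀ i, γ i) ℂ}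
    {G : Matrix (∀ i, α i) (∀ i, α i) ℂ → Matrix (∀ i, β i) (∀ i, β i) ℂ}
    (hF : F ∈ sepCone β γ) (hG : G ∈ closedSepCone α β) : F ∘ G ∈ closedSepCone α γ := by
  have hcont : Continuous fun G : Matrix (∀ i, α i) (∀ i, α i) ℂ → Matrix (∀ i, β i) (∀ i, β i) ℂ =>
      F ∘ G :=
    continuous_pi fun X => (sepCone_properties hF).1.comp (continuous_apply X)
  exact map_mem_closure hcont hG fun G hG => sepCone_comp hF hG

theorem isClosed_closedSepCone : IsClosed (closedSepCone α β : Set (Matrix (∀ i, α i) (∀ i, α i) ℂ →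
    Matrix (∀ i, β i) (∀ i, β i) ℂ)) :=
  AddSubmonoid.isClosed_topologicalClosure _

theorem mem_closedSepCone_of_hasSum {ι : Type}
    {F : ι → Matrix (∀ i, α i) (∀ i, α i) ℂ → Matrix (∀ i, β i) (∀ i, β i) ℂ}
    {G : Matrix (∀ i, α i) (∀ i, α i) ℂ → Matrix (∀ i, β i) (∀ i, β i) ℂ}
    (hF : ∀ j, F j ∈ closedSepCone α β) (hG : ∀ X, HasSum (fun j => F j X) (G X)) :
    G ∈ closedSepCone α β := by
  have h : HasSum F G := Pi.hasSum.mpr hG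
  exact isClosed_closedSepCone.mem_of_tendsto h
    (Eventually.of_forall fun s => AddSubmonoid.sum_mem _ fun j _ => hF j)

/-- Separable maps send pure states to operators of nonnegative trace. -/
theorem trace_nonneg_of_mem_closedSepCone [∀ i, Fintype (β i)]
    {F : Matrix (∀ i, α i) (∀ i, α i) ℂ → Matrix (∀ i, β i) (∀ i, β i) ℂ}
    (hF : F ∈ closedSepCone α β) (v : (∀ i, α i) → ℂ) :
    0 ≤ (F (vecMulVec v (star v))).trace.re := by
  have hclosed : IsClosed {F : Matrix (∀ i, α i) (∀ i, α i) ℂ → Matrix (∀ i, β i) (∀ i, β i) ℂ |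
      0 ≤ (F (vecMulVec v (star v))).trace.re} := by
    refine isClosed_le continuous_const (Complex.continuous_re.comp ?_)
    exact Continuous.matrix_trace (continuous_apply _)
  refine closure_minimal ?_ hclosed hF
  intro F hF
  refine AddSubmonoid.closure_induction (motive := fun F _ => 0 ≤ (F (vecMulVec v (star v))).trace.re)
    ?_ ?_ ?_ hF
  · rintro _ ⟨K, rfl⟩
    simp only [conjMap]
    rw [Matrix.mul_vecMulVec, Matrix.vecMulVec_mul, ← Matrix.star_mulVec,
      Matrix.trace_vecMulVec, dotProduct]
    rw [Complex.re_sum]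
    refine Finset.sum_nonneg fun i _ => ?_
    simp only [Pi.star_apply, Complex.star_def, Complex.mul_conj, Complex.ofReal_re]
    exact Complex.normSq_nonneg _
  · simp
  · intro F F' _ _ h h'
    simpa [Matrix.trace_add] using add_nonneg h h'

/-- A tensor product of completely positive maps is separable. -/
theorem IsTensor.mem_sepCone {E : OpMap (∀ i, α i) (∀ i, β i)} {Φ : ∀ i, OpMap (α i) (β i)}
    (h : IsTensor E Φ) (hΦ : ∀ i, IsCP (Φ i)) : (E : _ → _) ∈ sepCone α β := by
  choose r K hK using hΦ
  have key : (E : Matrix (∀ i, α i) (∀ i, α i) ℂ → Matrix (∀ i, β i) (∀ i, β i) ℂ) =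
      ∑ l : ∀ i, Fin (r i), conjMap (localOp fun i => K i (l i)) := by
    funext X
    rw [Finset.sum_apply]
    refine localOp_induction (P := fun X => E X =
      ∑ l : ∀ i, Fin (r i), conjMap (localOp fun i => K i (l i)) X) ?_ ?_ ?_ ?_ X
    · intro X Y hX hY
      simp only [map_add, hX, hY, conjMap, Matrix.mul_add, Matrix.add_mul, Finset.sum_add_distrib]
    · intro c X hX
      simp only [map_smul, hX, conjMap, Matrix.mul_smul, Matrix.smul_mul, Finset.smul_sum]
    · simp [conjMap]
    · intro A
      rw [h A]
      simp only [hK, conjMap, localOp_conjTranspose, localOp_mul]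
      rw [localOp_sum (fun i l => K i l * A i * (K i l)ᴴ)]
  rw [key]
  exact AddSubmonoid.sum_mem _ fun l _ => AddSubmonoid.subset_closure ⟨_, rfl⟩

/-- A tensor product of trace preserving maps is trace preserving. -/
theorem IsTensor.isTP [∀ i, Fintype (β i)] {E : OpMap (∀ i, α i) (∀ i, β i)} {Φ : ∀ i, OpMap (α i) (β i)}
    (h : IsTensor E Φ) (hΦ : ∀ i, IsTP (Φ i)) : IsTP E := by
  intro X
  refine localOp_induction (P := fun X => (E X).trace = X.trace) ?_ ?_ ?_ ?_ X
  · intro X Y hX hY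
    simp [Matrix.trace_add, hX, hY]
  · intro c X hX
    simp [hX]
  · simp
  · intro A
    rw [h A, trace_localOp, trace_localOp]
    exact Finset.prod_congr rfl fun i _ => hΦ i _

end SepCone

/-! ### LOCC maps are limits of separable maps -/

section Instruments

variable {n : ℕ} {α β γ : Fin n → Type} [∀ i, Fintype (α i)] [∀ i, Fintype (β i)]
  [∀ i, Fintype (γ i)]

theorem IsOneWayLocal.mem_sepCone {k : Fin n} {J : ℕ → OpMap (∀ i, α i) (∀ i, β i)}
    (h : IsOneWayLocal k J) (j : ℕ) : (J j : _ → _) ∈ sepCone α β := by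
  obtain ⟨Φ, hcp, -, -, hJ⟩ := h
  exact (hJ j).mem_sepCone (hcp j)

/-- On product operators the trace factors, and only the factor of the leading party depends on the
outcome, as the other parties apply channels. -/
theorem IsOneWayLocal.hasSum_trace {k : Fin n} {J : ℕ → OpMap (∀ i, α i) (∀ i, β i)}
    (h : IsOneWayLocal k J) (X) : HasSum (fun m => (J m X).trace) X.trace := by
  obtain ⟨Φ, -, htp, hsum, hJ⟩ := h
  refine localOp_induction (P := fun X => HasSum (fun m => (J m X).trace) X.trace) ?_ ?_ ?_ ?_ X
  · intro X Y hX hY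
    simpa [Matrix.trace_add] using hX.add hY
  · intro c X hX
    simpa using hX.mul_left c
  · simp
  · intro A
    have hterm : ∀ m, (J m (localOp A)).trace =
        (Φ m k (A k)).trace * ∏ i ∈ Finset.univ.erase k, (A i).trace := by
      intro m
      rw [hJ m A, trace_localOp, ← Finset.mul_prod_erase Finset.univ _ (Finset.mem_univ k)]
      congr 1
      exact Finset.prod_congr rfl fun i hi => htp m i (Finset.ne_of_mem_erase hi) _
    rw [trace_localOp, ← Finset.mul_prod_erase Finset.univ _ (Finset.mem_univ k)]
    simp only [hterm]
    exact (hsum (A k)).mul_right _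

/-- The members of `J` are limits of separable maps, and together they preserve the trace of pure
states. -/
def IsSeparableInstrument (J : ℕ → OpMap (∀ i, α i) (∀ i, β i)) : Prop :=
  (∀ j, (J j : _ → _) ∈ closedSepCone α β) ∧
    ∀ v, HasSum (fun j => (J j (vecMulVec v (star v))).trace.re) (vecMulVec v (star v)).trace.re

/-- `Λ` is a limit of separable maps that preserves the trace of pure states. -/
def IsSeparableChannel (Λ : OpMap (∀ i, α i) (∀ i, β i)) : Prop :=
  (Λ : _ → _) ∈ closedSepCone α β ∧
    ∀ v, (Λ (vecMulVec v (star v))).trace.re = (vecMulVec v (star v)).trace.re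

theorem hasSum_re_trace {ι κ : Type} [Fintype κ] {F : ι → Matrix κ κ ℂ} {M : Matrix κ κ ℂ}
    (h : HasSum F M) : HasSum (fun j => (F j).trace.re) M.trace.re :=
  h.map (Complex.reCLM.toAddMonoidHom.comp (Matrix.traceAddMonoidHom κ ℂ))
    (Complex.continuous_re.comp (Continuous.matrix_trace continuous_id))

theorem IsOneWayLocal.isSeparableInstrument {k : Fin n} {J : ℕ → OpMap (∀ i, α i) (∀ i, β i)}
    (h : IsOneWayLocal k J) : IsSeparableInstrument J :=
  ⟨fun j => sepCone_le_closedSepCone (h.mem_sepCone j),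
    fun _ => Complex.hasSum_re (h.hasSum_trace _)⟩

/-- Coarse-graining regroups a double series along the fibres of `f`. Nonnegativity makes the
iterated sum unconditional; this is why trace preservation is tracked on pure states only, through
real parts. -/
theorem hasSum_fiberwise_of_nonneg {t : ℕ × ℕ → ℝ} {r u : ℕ → ℝ} {x : ℝ} {f : ℕ × ℕ → ℕ}
    (ht : ∀ p, 0 ≤ t p) (hrow : ∀ j, HasSum (fun m => t (j, m)) (r j)) (hr : HasSum r x)
    (hu : ∀ l, HasSum (fun p : {p : ℕ × ℕ // f p = l} => t p.1) (u l)) : HasSum u x := by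
  have hsummable : Summable t := by
    refine (summable_prod_of_nonneg ht).mpr ⟨fun j => (hrow j).summable, ?_⟩
    simpa only [(hrow _).tsum_eq] using hr.summable
  have htotal : HasSum t x := by
    rw [hr.unique (hsummable.hasSum.prod_fiberwise hrow)]
    exact hsummable.hasSum
  exact (((Equiv.sigmaFiberEquiv f).hasSum_iff).mpr htotal).sigma hu

theorem IsSeparableInstrument.linked {J : ℕ → OpMap (∀ i, α i) (∀ i, β i)}
    {J' : ℕ → OpMap (∀ i, α i) (∀ i, γ i)} (hJ : IsSeparableInstrument J)
    (h : IsLinked J J') : IsSeparableInstrument J' := by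
  obtain ⟨F, f, hF, hJ'⟩ := h
  choose k hk using hF
  have hmem : ∀ p : ℕ × ℕ, ⇑(F p.1 p.2) ∘ ⇑(J p.1) ∈ closedSepCone α γ := fun p =>
    closedSepCone_comp ((hk p.1).mem_sepCone p.2) (hJ.1 p.1)
  refine ⟨fun l => mem_closedSepCone_of_hasSum
    (F := fun p : {p : ℕ × ℕ // f p = l} => ⇑(F p.1.1 p.1.2) ∘ ⇑(J p.1.1))
    (fun p => hmem p.1) (hJ' l), fun v => ?_⟩
  have hnn : ∀ p : ℕ × ℕ, 0 ≤ (F p.1 p.2 (J p.1 (vecMulVec v (star v)))).trace.re := fun p =>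
    trace_nonneg_of_mem_closedSepCone (hmem p) v
  have hrow : ∀ j, HasSum (fun m => (F j m (J j (vecMulVec v (star v)))).trace.re)
      (J j (vecMulVec v (star v))).trace.re := fun j =>
    Complex.hasSum_re ((hk j).hasSum_trace (J j (vecMulVec v (star v))))
  exact hasSum_fiberwise_of_nonneg
    (t := fun p : ℕ × ℕ => (F p.1 p.2 (J p.1 (vecMulVec v (star v)))).trace.re)
    (f := f) hnn hrow (hJ.2 v) fun l => hasSum_re_trace (hJ' l (vecMulVec v (star v)))

theorem IsFiniteLOCC.isSeparableInstrument {J : ℕ → OpMap (∀ i, α i) (∀ i, β i)}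
    (h : IsFiniteLOCC J) : IsSeparableInstrument J := by
  induction h with
  | one k J h => exact h.isSeparableInstrument
  | next J J' _ hlink ih => exact ih.linked hlink

theorem IsSeparableInstrument.isSeparableChannel {J : ℕ → OpMap (∀ i, α i) (∀ i, β i)}
    {Λ : OpMap (∀ i, α i) (∀ i, β i)} (hJ : IsSeparableInstrument J)
    (h : ∀ X, HasSum (fun j => J j X) (Λ X)) : IsSeparableChannel Λ :=
  ⟨mem_closedSepCone_of_hasSum hJ.1 h, fun v => (hasSum_re_trace (h _)).unique (hJ.2 v)⟩

theorem IsReadout.isSeparableChannel {J : ℕ → OpMap (∀ i, α i) (∀ i, β i)}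
    {Λ : OpMap (∀ i, α i) (∀ i, γ i)} (h : IsReadout J Λ) (hJ : IsSeparableInstrument J) :
    IsSeparableChannel Λ := by
  obtain ⟨R, E, hR, hE, hΛ⟩ := h
  refine ⟨mem_closedSepCone_of_hasSum (fun j => closedSepCone_comp
    ((hE j).mem_sepCone fun i => (hR j i).1) (hJ.1 j)) hΛ, fun v => ?_⟩
  refine (hasSum_re_trace (hΛ _)).unique ?_
  simpa only [(hE _).isTP (fun i => (hR _ i).2) _] using hJ.2 v

theorem IsLOCCN.isSeparableChannel {Λ : OpMap (∀ i, α i) (∀ i, β i)} (h : IsLOCCN Λ) :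
    IsSeparableChannel Λ := by
  obtain ⟨J, hJ, hΛ⟩ := h
  exact hJ.isSeparableInstrument.isSeparableChannel hΛ

/-- Every stopped protocol is a separable channel, and both defining conditions survive the limit:
the cone is closed and the trace is continuous. -/
theorem IsLOCC.isSeparableChannel {Λ : OpMap (∀ i, α i) (∀ i, β i)} (h : IsLOCC Λ) :
    IsSeparableChannel Λ := by
  obtain ⟨D, J, L, h0, hs, hL, hlim⟩ := h
  have hJ : ∀ s, IsSeparableInstrument (J s) := by
    intro s
    induction s with
    | zero => exact h0.isSeparableInstrument
    | succ s ih => exact ih.linked (hs s)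
  have hLs := fun s => (hL s).isSeparableChannel (hJ s)
  refine ⟨isClosed_closedSepCone.mem_of_tendsto (tendsto_pi_nhds.mpr hlim)
    (Eventually.of_forall fun s => (hLs s).1), fun v => ?_⟩
  have hc : Continuous fun M : Matrix (∀ i, β i) (∀ i, β i) ℂ => M.trace.re :=
    Complex.continuous_re.comp (Continuous.matrix_trace continuous_id)
  refine tendsto_nhds_unique ((hc.tendsto _).comp (hlim (vecMulVec v (star v)))) ?_
  simp only [Function.comp_def, (hLs _).2 v, tendsto_const_nhds]

end Instruments

/-! ### Limits of separable maps are separable -/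

section Compactness

/-- By Carathéodory, `dim E + 1` points suffice for each convex combination, so the hull is a
continuous image of a simplex times a power of `s`. -/
theorem isCompact_convexHull {E : Type} [NormedAddCommGroup E] [NormedSpace ℝ E]
    [FiniteDimensional ℝ E] {s : Set E} (hs : IsCompact s) : IsCompact (convexHull ℝ s) := by
  classical
  set N := Module.finrank ℝ E + 1
  have himage : convexHull ℝ s = (fun p : (Fin N → ℝ) × (Fin N → E) => ∑ i, p.1 i • p.2 i) ''
      (stdSimplex ℝ (Fin N) ×ˢ Set.univ.pi fun _ => s) := by
    apply Set.Subset.antisymm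
    · intro x hx
      obtain ⟨ι, _, z, w, hz, haff, hw, hw1, rfl⟩ := eq_pos_convex_span_of_mem_convexHull hx
      have hcard : Fintype.card ι ≤ Fintype.card (Fin N) := by
        rw [Fintype.card_fin]
        exact haff.card_le_finrank_succ.trans (Nat.succ_le_succ (Submodule.finrank_le _))
      obtain ⟨e⟩ := Function.Embedding.nonempty_of_card_le hcard
      have hne : Nonempty ι := by
        by_contra h
        rw [not_nonempty_iff] at h
        simp at hw1
      obtain ⟨i₀⟩ := hne
      have hextend : ∀ (M : Type) [AddCommMonoid M] (g : Fin N → M), (∀ j ∉ Set.range e, g j = 0) →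
          ∑ j, g j = ∑ i, g (e i) := by
        intro M _ g hg
        rw [← Finset.sum_map Finset.univ e g]
        refine (Finset.sum_subset (Finset.subset_univ _) fun j _ hj => hg j ?_).symm
        simpa using hj
      have hwe : ∀ i, Function.extend e w 0 (e i) = w i := fun i => e.injective.extend_apply _ _ _
      have hze : ∀ i, Function.extend e z (fun _ => z i₀) (e i) = z i :=
        fun i => e.injective.extend_apply _ _ _
      have hw0 : ∀ j ∉ Set.range e, Function.extend e w 0 j = 0 := fun j hj =>
        Function.extend_apply' _ _ _ hj
      -- A shorter combination is padded to length `N` with zero weights, and with the point `z i₀`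
      -- so that the padding stays in `s`.
      refine ⟨(Function.extend e w 0, Function.extend e z fun _ => z i₀), ⟨⟨fun j => ?_, ?_⟩, ?_⟩, ?_⟩
      · by_cases hj : j ∈ Set.range e
        · obtain ⟨i, rfl⟩ := hj
          simpa only [hwe] using (hw i).le
        · exact (hw0 j hj).ge
      · rw [hextend ℝ _ hw0, ← hw1]
        exact Finset.sum_congr rfl fun i _ => hwe i
      · intro j _
        by_cases hj : j ∈ Set.range e
        · obtain ⟨i, rfl⟩ := hj
          simpa only [hze] using hz ⟨i, rfl⟩
        · simp only [Function.extend_apply' _ _ _ hj]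
          exact hz ⟨i₀, rfl⟩
      · simp only
        rw [hextend E _ fun j hj => by rw [hw0 j hj, zero_smul]]
        exact Finset.sum_congr rfl fun i _ => by rw [hwe, hze]
    · rintro _ ⟨⟨w, z⟩, ⟨hw, hz⟩, rfl⟩
      exact (convex_convexHull ℝ s).sum_mem (fun i _ => hw.1 i) hw.2
        fun i _ => subset_convexHull ℝ s (hz i (Set.mem_univ i))
  rw [himage]
  exact ((isCompact_stdSimplex ℝ (Fin N)).prod (isCompact_univ_pi fun _ => hs)).image (by fun_prop)

/-- A limit of conic combinations of elements of a compact set is a conic combination as well, if the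
total weight `τ` of a combination depends continuously on its value. -/
theorem exists_smul_convexHull_of_mem_closure {E : Type} [NormedAddCommGroup E] [NormedSpace ℝ E]
    [FiniteDimensional ℝ E] {s C : Set E} (hs : IsCompact s) {τ : E → ℝ} (hτ : Continuous τ)
    (hC : ∀ x ∈ C, 0 ≤ τ x ∧ ∃ y ∈ convexHull ℝ s, x = τ x • y) {x : E} (hx : x ∈ closure C) :
    ∃ t : ℝ, 0 ≤ t ∧ ∃ y ∈ convexHull ℝ s, x = t • y := by
  -- Near `x` the weights stay below `τ x + 1`, so the approximants lie in a compact, hence closed,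
  -- set of combinations with bounded weight.
  have hcompact : IsCompact ((fun p : ℝ × E => p.1 • p.2) ''
      (Set.Icc 0 (τ x + 1) ×ˢ convexHull ℝ s)) :=
    (isCompact_Icc.prod (isCompact_convexHull hs)).image (by fun_prop)
  have hopen : IsOpen {y | τ y < τ x + 1} := isOpen_lt hτ continuous_const
  have hx' : x ∈ closure (C ∩ {y | τ y < τ x + 1}) := by
    rw [Set.inter_comm]
    exact hopen.inter_closure ⟨by simp, hx⟩
  have hsub : C ∩ {y | τ y < τ x + 1} ⊆ (fun p : ℝ × E => p.1 • p.2) ''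
      (Set.Icc 0 (τ x + 1) ×ˢ convexHull ℝ s) := by
    rintro z ⟨hz, hz'⟩
    obtain ⟨h0, y, hy, hzy⟩ := hC z hz
    exact ⟨(τ z, y), ⟨⟨h0, le_of_lt hz'⟩, hy⟩, hzy.symm⟩
  obtain ⟨⟨t, y⟩, ⟨ht, hy⟩, rfl⟩ := closure_minimal hsub hcompact.isClosed hx'
  exact ⟨t, ht.1, y, hy, rfl⟩

end Compactness

/-! ### Choi operators and finite product Kraus decompositions -/

section FiniteKraus

variable {n : ℕ} {α β : Fin n → Type} [∀ i, Fintype (α i)] [∀ i, Fintype (β i)]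

/-- The linear map with the single Kraus operator `M`. -/
noncomputable def conjLin {ι κ : Type} [Fintype ι] (M : Matrix κ ι ℂ) : OpMap ι κ where
  toFun := conjMap M
  map_add' X Y := by simp [conjMap, Matrix.mul_add, Matrix.add_mul]
  map_smul' c X := by simp [conjMap]

/-- The matrix entries of the Choi operator of a map. -/
noncomputable def choi {ι κ : Type} [DecidableEq ι] (Φ : Matrix ι ι ℂ → Matrix κ κ ℂ) :
    ι → ι → κ → κ → ℂ :=
  fun a a' b b' => Φ (Matrix.single a a' 1) b b'

/-- The trace of the Choi operator. -/
noncomputable def choiTrace {ι κ : Type} [Fintype ι] [Fintype κ] (x : ι → ι → κ → κ → ℂ) : ℝ :=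
  (∑ a, ∑ b, x a a b b).re

theorem continuous_choi {ι κ : Type} [DecidableEq ι] :
    Continuous (choi : (Matrix ι ι ℂ → Matrix κ κ ℂ) → _) := by
  unfold choi
  fun_prop

theorem continuous_choiTrace {ι κ : Type} [Fintype ι] [Fintype κ] :
    Continuous (choiTrace : (ι → ι → κ → κ → ℂ) → ℝ) := by
  unfold choiTrace
  exact Complex.continuous_re.comp (by fun_prop)

theorem choiTrace_add {ι κ : Type} [Fintype ι] [Fintype κ] (x y : ι → ι → κ → κ → ℂ) :
    choiTrace (x + y) = choiTrace x + choiTrace y := by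
  simp [choiTrace, Finset.sum_add_distrib]

theorem choi_conjMap {ι κ : Type} [Fintype ι] [DecidableEq ι] (M : Matrix κ ι ℂ) (a a' b b') :
    choi (conjMap M) a a' b b' = M b a * star (M b' a') := by
  simp [choi, conjMap, Matrix.mul_apply, Matrix.single_apply, ite_and]

/-- The Choi trace is the squared Hilbert–Schmidt norm of the Kraus operator. It serves as the total
weight of a conic combination and is continuous in the map. -/
theorem choiTrace_conjMap {ι κ : Type} [Fintype ι] [DecidableEq ι] [Fintype κ] (M : Matrix κ ι ℂ) :
    choiTrace (choi (conjMap M)) = (M * Mᴴ).trace.re := by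
  simp only [choiTrace, choi_conjMap, Matrix.trace, Matrix.diag_apply, Matrix.mul_apply,
    Matrix.conjTranspose_apply]
  rw [Finset.sum_comm]

theorem trace_mul_conjTranspose {ι κ : Type} [Fintype ι] [Fintype κ] (M : Matrix κ ι ℂ) :
    (M * Mᴴ).trace = ((∑ b, ∑ a, ‖M b a‖ ^ 2 : ℝ) : ℂ) := by
  simp only [Matrix.trace, Matrix.diag_apply, Matrix.mul_apply, Matrix.conjTranspose_apply]
  push_cast
  refine Finset.sum_congr rfl fun b _ => Finset.sum_congr rfl fun a _ => ?_
  exact Complex.mul_conj' _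

theorem isCompact_unit_trace {ι κ : Type} [Fintype ι] [Fintype κ] :
    IsCompact {M : Matrix κ ι ℂ | (M * Mᴴ).trace = 1} := by
  have hball : IsCompact (Set.univ.pi fun _ : κ => Set.univ.pi fun _ : ι =>
      Metric.closedBall (0 : ℂ) 1) :=
    isCompact_univ_pi fun _ => isCompact_univ_pi fun _ => isCompact_closedBall 0 1
  have hclosed : IsClosed {M : Matrix κ ι ℂ | (M * Mᴴ).trace = 1} :=
    isClosed_eq (by fun_prop) continuous_const
  refine IsCompact.of_isClosed_subset hball hclosed fun M hM b _ a _ => ?_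
  rw [Set.mem_ofPred_eq, trace_mul_conjTranspose] at hM
  have hM' : ∑ b, ∑ a, ‖M b a‖ ^ 2 = 1 := by exact_mod_cast hM
  have h1 : ‖M b a‖ ^ 2 ≤ 1 := by
    rw [← hM']
    refine (Finset.single_le_sum (f := fun a => ‖M b a‖ ^ 2) (fun _ _ => by positivity)
      (Finset.mem_univ a)).trans ?_
    exact Finset.single_le_sum (f := fun b => ∑ a, ‖M b a‖ ^ 2) (fun _ _ => by positivity)
      (Finset.mem_univ b)
  rw [mem_closedBall_zero_iff]
  exact (sq_le_one_iff₀ (norm_nonneg _)).mp h1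

open Classical in
/-- The Choi operators of normalized product Kraus operators. -/
noncomputable def productChoi (α β : Fin n → Type) [∀ i, Fintype (α i)] [∀ i, Fintype (β i)] :
    Set ((∀ i, α i) → (∀ i, α i) → (∀ i, β i) → (∀ i, β i) → ℂ) :=
  (fun K : ∀ i, Matrix (β i) (α i) ℂ => choi (conjMap (localOp K))) ''
    Set.univ.pi fun i => {M : Matrix (β i) (α i) ℂ | (M * Mᴴ).trace = 1}

theorem isCompact_productChoi : IsCompact (productChoi α β) := by
  classical
  refine IsCompact.image (isCompact_univ_pi fun i => isCompact_unit_trace) ?_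
  refine continuous_pi fun a => continuous_pi fun a' => continuous_pi fun b => continuous_pi fun b' => ?_
  simp only [choi_conjMap, localOp_apply]
  fun_prop

theorem productChoi_nonempty [∀ i, Nonempty (α i)] [∀ i, Nonempty (β i)] :
    (productChoi α β).Nonempty := by
  classical
  refine Set.Nonempty.image _ (Set.univ_pi_nonempty_iff.mpr fun i => ?_)
  obtain ⟨a⟩ := ‹∀ i, Nonempty (α i)› i
  obtain ⟨b⟩ := ‹∀ i, Nonempty (β i)› i
  refine ⟨Matrix.single b a 1, ?_⟩
  simp

-- A product Kraus operator is normalized factor by factor; the weight split off is the product of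
-- the squared norms, which is its Choi trace. Weights add under sums of maps.
open scoped Pointwise Classical in
theorem choi_eq_smul_of_mem_sepCone [∀ i, Nonempty (α i)] [∀ i, Nonempty (β i)]
    {F : Matrix (∀ i, α i) (∀ i, α i) ℂ → Matrix (∀ i, β i) (∀ i, β i) ℂ} (hF : F ∈ sepCone α β) :
    0 ≤ choiTrace (choi F) ∧
      ∃ y ∈ convexHull ℝ (productChoi α β), choi F = choiTrace (choi F) • y := by
  have hne : (convexHull ℝ (productChoi α β)).Nonempty := productChoi_nonempty.convexHull
  refine AddSubmonoid.closure_induction (motive := fun F _ => 0 ≤ choiTrace (choi F) ∧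
      ∃ y ∈ convexHull ℝ (productChoi α β), choi F = choiTrace (choi F) • y) ?_ ?_ ?_ hF
  · rintro _ ⟨K, rfl⟩
    simp only
    set r : Fin n → ℝ := fun i => ∑ b, ∑ a, ‖K i b a‖ ^ 2 with hr
    have hr0 : ∀ i, 0 ≤ r i := fun i => by positivity
    have htr : choiTrace (choi (conjMap (localOp K))) = ∏ i, r i := by
      rw [choiTrace_conjMap, localOp_conjTranspose, localOp_mul, trace_localOp]
      simp only [trace_mul_conjTranspose]
      rw [← Complex.ofReal_prod, Complex.ofReal_re]
    rw [htr]
    refine ⟨Finset.prod_nonneg fun i _ => hr0 i, ?_⟩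
    -- A vanishing factor cannot be normalized, but then the map is zero and any point of the hull
    -- serves.
    by_cases hz : ∃ i, r i = 0
    · obtain ⟨i, hi⟩ := hz
      have hK : K i = 0 := by
        ext b a
        have h1 := (Finset.sum_eq_zero_iff_of_nonneg fun b _ => by positivity).mp hi b
          (Finset.mem_univ b)
        have h2 := (Finset.sum_eq_zero_iff_of_nonneg fun a _ => by positivity).mp h1 a
          (Finset.mem_univ a)
        simpa using h2
      obtain ⟨y, hy⟩ := hne
      refine ⟨y, hy, ?_⟩
      rw [Finset.prod_eq_zero (Finset.mem_univ i) hi, zero_smul, localOp_eq_zero hK]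
      funext a a' b b'
      simp [choi_conjMap]
    · push Not at hz
      have hpos : ∀ i, 0 < r i := fun i => lt_of_le_of_ne (hr0 i) (hz i).symm
      have hsq : ∀ i, (((√(r i))⁻¹ : ℝ) : ℂ) * (((√(r i))⁻¹ : ℝ) : ℂ) = ((r i)⁻¹ : ℝ) := by
        intro i
        rw [← Complex.ofReal_mul, ← mul_inv, Real.mul_self_sqrt (hr0 i)]
      refine ⟨_, subset_convexHull ℝ _ ⟨fun i => (((√(r i))⁻¹ : ℝ) : ℂ) • K i, fun i _ => ?_, rfl⟩, ?_⟩
      · rw [Set.mem_ofPred_eq, Matrix.conjTranspose_smul, Matrix.smul_mul, Matrix.mul_smul, smul_smul,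
          Matrix.trace_smul, trace_mul_conjTranspose, Complex.star_def, Complex.conj_ofReal, hsq,
          smul_eq_mul, ← Complex.ofReal_mul, inv_mul_cancel₀ (hz i), Complex.ofReal_one]
      · funext a a' b b'
        simp only [Pi.smul_apply, choi_conjMap]
        rw [localOp_smul, Matrix.smul_apply, Matrix.smul_apply, smul_eq_mul, smul_eq_mul, star_mul',
          Complex.star_def, map_prod]
        simp only [Complex.conj_ofReal]
        rw [Complex.real_smul, mul_mul_mul_comm, ← Finset.prod_mul_distrib,
          Finset.prod_congr rfl fun i _ => hsq i, ← Complex.ofReal_prod, ← mul_assoc,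
          ← Complex.ofReal_mul, ← Finset.prod_mul_distrib,
          Finset.prod_congr rfl fun i _ => mul_inv_cancel₀ (hz i)]
        simp
  · obtain ⟨y, hy⟩ := hne
    have h0 : choi (0 : Matrix (∀ i, α i) (∀ i, α i) ℂ → Matrix (∀ i, β i) (∀ i, β i) ℂ) = 0 := rfl
    rw [h0]
    refine ⟨by simp [choiTrace], y, hy, ?_⟩
    simp [choiTrace]
  · rintro F G - - ⟨hF, y, hy, hFy⟩ ⟨hG, z, hz, hGz⟩
    have hadd : choi (F + G) = choi F + choi G := rfl
    rw [hadd, choiTrace_add]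
    refine ⟨add_nonneg hF hG, ?_⟩
    -- For a convex set `C` and nonnegative `s`, `t`, one has `(s + t) • C = s • C + t • C`.
    have hmem : choi F + choi G ∈ (choiTrace (choi F) + choiTrace (choi G)) •
        convexHull ℝ (productChoi α β) := by
      rw [(convex_convexHull ℝ _).add_smul hF hG]
      exact Set.add_mem_add ⟨y, hy, hFy.symm⟩ ⟨z, hz, hGz.symm⟩
    obtain ⟨w, hw, hw'⟩ := hmem
    exact ⟨w, hw, hw'.symm⟩

/-- A limit of separable maps has finitely many Kraus operators, each proportional to a product
operator. -/
theorem exists_kraus_of_mem_closedSepCone [∀ i, Nonempty (α i)] [∀ i, Nonempty (β i)]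
    {Λ : OpMap (∀ i, α i) (∀ i, β i)} (hΛ : (Λ : _ → _) ∈ closedSepCone α β) :
    ∃ (L : Type) (_ : Fintype L) (s : L → ℂ) (K : L → ∀ i, Matrix (β i) (α i) ℂ),
      ∀ X, Λ X = ∑ l, conjMap (s l • localOp (K l)) X := by
  classical
  have hcl : choi Λ ∈ closure (choi '' (sepCone α β : Set (Matrix (∀ i, α i) (∀ i, α i) ℂ →
      Matrix (∀ i, β i) (∀ i, β i) ℂ))) :=
    image_closure_subset_closure_image continuous_choi ⟨_, hΛ, rfl⟩
  obtain ⟨t, ht, y, hy, hty⟩ := exists_smul_convexHull_of_mem_closure isCompact_productChoi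
    continuous_choiTrace (by
      rintro _ ⟨F, hF, rfl⟩
      exact choi_eq_smul_of_mem_sepCone hF) hcl
  obtain ⟨L, _, z, w, hz, -, hw, -, rfl⟩ := eq_pos_convex_span_of_mem_convexHull hy
  choose K hK hKz using fun l => hz ⟨l, rfl⟩
  -- The conic weight `t * w l` is absorbed into the Kraus operator, on which the map depends
  -- quadratically; hence the square root.
  refine ⟨L, inferInstance, fun l => ((√(t * w l) : ℝ) : ℂ), K, fun X => ?_⟩
  have hlin : Λ = ∑ l, conjLin (((√(t * w l) : ℝ) : ℂ) • localOp (K l)) := by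
    refine Matrix.ext_linearMap ℂ fun a a' => LinearMap.ext_ring ?_
    ext b b'
    have hentry := congrFun (congrFun (congrFun (congrFun hty a) a') b) b'
    have hleft : choi Λ a a' b b' = Λ (Matrix.single a a' 1) b b' := rfl
    have hright : ∀ l, conjLin (((√(t * w l) : ℝ) : ℂ) • localOp (K l)) (Matrix.single a a' 1) b b' =
        choi (conjMap (((√(t * w l) : ℝ) : ℂ) • localOp (K l))) a a' b b' := fun l => rfl
    simp only [LinearMap.comp_apply, Matrix.singleLinearMap_apply, LinearMap.sum_apply,
      Matrix.sum_apply]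
    simp only [hright]
    rw [← hleft, hentry]
    simp only [Pi.smul_apply, Finset.sum_apply, Finset.smul_sum, ← hKz, choi_conjMap,
      Matrix.smul_apply, smul_eq_mul, star_mul', Complex.star_def, Complex.conj_ofReal,
      Complex.real_smul]
    refine Finset.sum_congr rfl fun l _ => ?_
    rw [mul_mul_mul_comm, ← Complex.ofReal_mul, Real.mul_self_sqrt (mul_nonneg ht (hw l).le)]
    push_cast
    ring
  conv_lhs => rw [hlin]
  rw [LinearMap.sum_apply]
  rfl

end FiniteKraus

/-! ### Linear algebra -/

section LinearAlgebra

open scoped ComplexOrder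

/-- If a sum of rank-one positive operators is a multiple of `|b⟩⟨b|`, then each of them is. -/
theorem exists_smul_of_sum_vecMulVec {L κ : Type} [Fintype L] [Fintype κ] (v : L → κ → ℂ)
    {b : κ → ℂ} (hb : b ≠ 0) {t : ℂ}
    (h : ∑ l, vecMulVec (v l) (star (v l)) = t • vecMulVec b (star b)) (l : L) :
    ∃ c : ℂ, v l = c • b := by
  have hbb : star b ⬝ᵥ b ≠ 0 := fun h0 => hb (dotProduct_star_self_eq_zero.mp h0)
  -- Sandwiching the identity between `w` and itself makes a sum of squares `|⟨v i, w⟩|²` vanish.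
  have horth : ∀ w : κ → ℂ, star b ⬝ᵥ w = 0 → star (v l) ⬝ᵥ w = 0 := by
    intro w hw
    have h1 := congrArg (fun M : Matrix κ κ ℂ => star w ⬝ᵥ (M *ᵥ w)) h
    simp only [Matrix.sum_mulVec, Matrix.smul_mulVec, Matrix.vecMulVec_mulVec, dotProduct_sum,
      hw, MulOpposite.op_zero, zero_smul, smul_zero, dotProduct_zero] at h1
    have h2 : ∀ i, star w ⬝ᵥ (MulOpposite.op (star (v i) ⬝ᵥ w) • v i) =
        ((‖star (v i) ⬝ᵥ w‖ ^ 2 : ℝ) : ℂ) := by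
      intro i
      rw [op_smul_eq_smul, dotProduct_smul, smul_eq_mul, Complex.ofReal_pow, ← Complex.mul_conj',
        ← Complex.star_def, ← Matrix.star_dotProduct_star, star_star]
    simp only [h2] at h1
    have h3 : ∑ i, ‖star (v i) ⬝ᵥ w‖ ^ 2 = 0 := by exact_mod_cast h1
    have h4 := (Finset.sum_eq_zero_iff_of_nonneg fun i _ => by positivity).mp h3 l
      (Finset.mem_univ l)
    simpa using h4
  refine ⟨(star b ⬝ᵥ v l) / (star b ⬝ᵥ b), ?_⟩
  set c := (star b ⬝ᵥ v l) / (star b ⬝ᵥ b) with hc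
  have hw : star b ⬝ᵥ (v l - c • b) = 0 := by
    rw [dotProduct_sub, dotProduct_smul, smul_eq_mul, hc, div_mul_cancel₀ _ hbb, sub_self]
  have hz : star (v l - c • b) ⬝ᵥ (v l - c • b) = 0 := by
    rw [star_sub, sub_dotProduct, horth _ hw, star_smul, smul_dotProduct, hw, smul_zero, sub_zero]
  exact sub_eq_zero.mp (dotProduct_star_self_eq_zero.mp hz)

/-- At `a + Q a` the two cross terms of the form both equal `‖Q a‖²`, and the diagonal terms vanish.
-/
theorem eq_zero_of_quadratic_form {ι : Type} [Fintype ι] {Q : Matrix ι ι ℂ} (hQ : Qᴴ = Q)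
    (h : ∀ v : ι → ℂ, (star v ⬝ᵥ (Q *ᵥ v)).re = 0) (a : ι → ℂ) : Q *ᵥ a = 0 := by
  have h1 := h (a + Q *ᵥ a)
  have h2 : star a ⬝ᵥ (Q *ᵥ (Q *ᵥ a)) = star (Q *ᵥ a) ⬝ᵥ (Q *ᵥ a) := by
    rw [Matrix.star_mulVec, hQ, ← Matrix.dotProduct_mulVec]
  rw [Matrix.mulVec_add, star_add, dotProduct_add, add_dotProduct, add_dotProduct, h2,
    Complex.add_re, Complex.add_re, Complex.add_re, h a, h (Q *ᵥ a)] at h1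
  have h3 : (star (Q *ᵥ a) ⬝ᵥ (Q *ᵥ a)).re = 0 := by linarith
  have h4 : star (Q *ᵥ a) ⬝ᵥ (Q *ᵥ a) = ((∑ i, ‖(Q *ᵥ a) i‖ ^ 2 : ℝ) : ℂ) := by
    simp only [dotProduct, Pi.star_apply, Complex.star_def]
    push_cast
    exact Finset.sum_congr rfl fun i _ => Complex.conj_mul' _
  rw [h4, Complex.ofReal_re] at h3
  refine dotProduct_star_self_eq_zero.mp (h4.trans ?_)
  rw [h3, Complex.ofReal_zero]

/-- Trace preservation on pure states says that the Hermitian matrix `∑ Mᴴ M - 1` has zero quadratic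
form, so it annihilates every vector. -/
theorem sum_conjTranspose_mul_mulVec {L ι κ : Type} [Fintype L] [Fintype ι] [Fintype κ]
    (M : L → Matrix κ ι ℂ)
    (h : ∀ v, (∑ l, conjMap (M l) (vecMulVec v (star v))).trace.re = (vecMulVec v (star v)).trace.re)
    (a : ι → ℂ) : ∑ l, (M l)ᴴ *ᵥ (M l *ᵥ a) = a := by
  classical
  set Q : Matrix ι ι ℂ := ∑ l, (M l)ᴴ * M l - 1 with hQdef
  have hQ : Qᴴ = Q := by
    rw [hQdef, Matrix.conjTranspose_sub, Matrix.conjTranspose_sum, Matrix.conjTranspose_one]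
    simp [Matrix.conjTranspose_mul]
  have hform : ∀ v : ι → ℂ, (star v ⬝ᵥ (Q *ᵥ v)).re = 0 := by
    intro v
    have hv := h v
    have hterm : ∀ l, (conjMap (M l) (vecMulVec v (star v))).trace =
        star v ⬝ᵥ (((M l)ᴴ * M l) *ᵥ v) := by
      intro l
      simp only [conjMap]
      rw [Matrix.mul_vecMulVec, Matrix.vecMulVec_mul, ← Matrix.star_mulVec, Matrix.trace_vecMulVec,
        dotProduct_comm, Matrix.star_mulVec, ← Matrix.dotProduct_mulVec, Matrix.mulVec_mulVec]
    rw [Matrix.trace_sum, Finset.sum_congr rfl fun l _ => hterm l, Matrix.trace_vecMulVec,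
      dotProduct_comm v] at hv
    rw [hQdef, Matrix.sub_mulVec, Matrix.one_mulVec, dotProduct_sub, Matrix.sum_mulVec,
      dotProduct_sum, Complex.sub_re, hv, sub_self]
  have hzero := eq_zero_of_quadratic_form hQ hform a
  rw [hQdef, Matrix.sub_mulVec, Matrix.one_mulVec, Matrix.sum_mulVec, sub_eq_zero] at hzero
  simpa only [Matrix.mulVec_mulVec] using hzero

/-- The vectors `u` and `x` agree up to a nonzero scalar. -/
def IsProportional {σ : Type} (u x : σ → ℂ) : Prop := ∃ c : ℂ, c ≠ 0 ∧ u = c • x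

theorem IsProportional.symm {σ : Type} {u x : σ → ℂ} (h : IsProportional u x) :
    IsProportional x u := by
  obtain ⟨c, hc, rfl⟩ := h
  exact ⟨c⁻¹, inv_ne_zero hc, by rw [smul_smul, inv_mul_cancel₀ hc, one_smul]⟩

theorem isProportional_of_mul_eq {σ : Type} {u v x y : σ → ℂ} (hu : u ≠ 0) (hv : v ≠ 0) {k : ℂ}
    (h : ∀ s t, u s * v t = k * (x s * y t)) : IsProportional u x ∧ IsProportional v y := by
  obtain ⟨s₀, hs⟩ := Function.ne_iff.mp hu
  obtain ⟨t₀, ht⟩ := Function.ne_iff.mp hv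
  simp only [Pi.zero_apply] at hs ht
  have h0 : k * (x s₀ * y t₀) ≠ 0 := h s₀ t₀ ▸ mul_ne_zero hs ht
  have hk := left_ne_zero_of_mul h0
  have hx := left_ne_zero_of_mul (right_ne_zero_of_mul h0)
  have hy := right_ne_zero_of_mul (right_ne_zero_of_mul h0)
  refine ⟨⟨k * y t₀ / v t₀, by positivity, ?_⟩, ⟨k * x s₀ / u s₀, by positivity, ?_⟩⟩
  · funext s
    rw [Pi.smul_apply, smul_eq_mul, div_mul_eq_mul_div, eq_div_iff ht, h]
    ring
  · funext t
    rw [Pi.smul_apply, smul_eq_mul, div_mul_eq_mul_div, eq_div_iff hs, mul_comm, h]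
    ring

/-- A product vector in the span of `x ⊗ y` and `y ⊗ x` is one of these two, up to scaling of the
factors. -/
theorem isProportional_of_mul_eq_add {σ : Type} {u v x y : σ → ℂ} (hu : u ≠ 0) (hv : v ≠ 0)
    {p q : ℂ}
    (h : ∀ s t, u s * v t = p * (x s * y t) + q * (y s * x t)) :
    (IsProportional u x ∧ IsProportional v y) ∨ (IsProportional u y ∧ IsProportional v x) := by
  by_cases hp : p = 0
  · right
    exact isProportional_of_mul_eq hu hv fun s t => by rw [h, hp]; ring
  by_cases hq : q = 0
  · left
    exact isProportional_of_mul_eq hu hv fun s t => by rw [h, hq]; ring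
  -- The 2×2 minors of `u ⊗ v` vanish. With rows and columns `s`, `t` this reads `p q (x s y t - y s
  -- x t)² = 0`, so `x ⊗ y = y ⊗ x` when `p` and `q` are both nonzero.
  have hminor : ∀ s t, x s * y t = y s * x t := by
    intro s t
    have h1 : u s * v s * (u t * v t) = u s * v t * (u t * v s) := by ring
    rw [h, h, h, h] at h1
    have h2 : p * q * (x s * y t - y s * x t) ^ 2 = 0 := by linear_combination (-1 : ℂ) * h1
    have h3 := (mul_eq_zero.mp h2).resolve_left (mul_ne_zero hp hq)
    exact sub_eq_zero.mp (pow_eq_zero_iff two_ne_zero |>.mp h3)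
  left
  exact isProportional_of_mul_eq (k := p + q) hu hv fun s t => by rw [h, ← hminor]; ring

end LinearAlgebra

/-! ### Local invertibility -/

section FullLocalRank

variable {n : ℕ} {α : Type} [Fintype α]

/-- Every local contraction of `φ` with a nonzero vector is nonzero. -/
def HasFullLocalRank (φ : (Fin n → α) → ℂ) : Prop :=
  ∀ (i : Fin n) (v : α → ℂ), (∀ x, ∑ a, v a * φ (Function.update x i a) = 0) → v = 0

/-- A vector whose contraction with `ψ` vanishes lies in the left kernel of the reduced density
matrix, which is invertible. -/
theorem FullyEntangled.hasFullLocalRank {d : ℕ} {ψ : (Fin n → Fin d) → ℂ} (h : FullyEntangled ψ) :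
    HasFullLocalRank ψ := by
  intro i v hv
  have hunit : IsUnit (reducedDensity ψ i) := by
    rw [← Matrix.mulVec_surjective_iff_isUnit]
    have htop : LinearMap.range (reducedDensity ψ i).mulVecLin = ⊤ := by
      refine Submodule.eq_top_of_finrank_eq ?_
      simpa [Matrix.rank] using h i
    exact LinearMap.range_eq_top.mp htop
  have hzero : v ᵥ* reducedDensity ψ i = 0 := by
    funext b
    have h1 : (v ᵥ* reducedDensity ψ i) b =
        ∑ x : Fin n → Fin d, v (x i) * ψ x * star (ψ (Function.update x i b)) := by
      simp only [Matrix.vecMul, dotProduct, reducedDensity, Matrix.of_apply, Finset.mul_sum,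
        Finset.sum_filter, mul_ite, mul_zero]
      rw [Finset.sum_comm]
      refine Finset.sum_congr rfl fun x _ => ?_
      simp [mul_assoc]
    rw [h1, ← (Equiv.funSplitAt i (Fin d)).symm.sum_comp, Fintype.sum_prod_type, Finset.sum_comm]
    refine Finset.sum_eq_zero fun z _ => ?_
    have hsplit : ∀ a, (Equiv.funSplitAt i (Fin d)).symm (a, z) =
        Function.update ((Equiv.funSplitAt i (Fin d)).symm (b, z)) i a := by
      intro a
      funext j
      by_cases hj : j = i
      · subst hj; simp
      · simp [hj]
    calc _ = (∑ a, v a * ψ (Function.update ((Equiv.funSplitAt i (Fin d)).symm (b, z)) i a)) *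
          star (ψ ((Equiv.funSplitAt i (Fin d)).symm (b, z))) := by
          rw [Finset.sum_mul]
          refine Finset.sum_congr rfl fun a _ => ?_
          rw [hsplit a, Function.update_self, Function.update_idem, ← hsplit b]
      _ = 0 := by rw [hv, zero_mul]
  exact Matrix.vecMul_injective_iff_isUnit.mpr hunit (by simpa using hzero)

/-- Contract one copy at a time: the partial contraction with `χ` is annihilated by `φ`, hence zero,
and then `χ` annihilates each row of `v`. -/
theorem HasFullLocalRank.pair {d : ℕ} {φ χ : (Fin n → Fin d) → ℂ} (hφ : HasFullLocalRank φ)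
    (hχ : HasFullLocalRank χ) : HasFullLocalRank (pair φ χ) := by
  intro i v hv
  have h1 : ∀ (y : Fin n → Fin d) (a : Fin d),
      ∑ b, v (a, b) * χ (Function.update y i b) = 0 := by
    intro y
    refine congrFun (hφ i (fun a => ∑ b, v (a, b) * χ (Function.update y i b)) fun x => ?_)
    have h2 := hv fun j => (x j, y j)
    rw [Fintype.sum_prod_type] at h2
    rw [← h2]
    refine Finset.sum_congr rfl fun a _ => ?_
    rw [Finset.sum_mul]
    refine Finset.sum_congr rfl fun b _ => ?_
    have e1 : (fun j => (Function.update (fun j => (x j, y j)) i (a, b) j).1) =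
        Function.update x i a := by
      funext j; by_cases hj : j = i
      · subst hj; simp
      · simp [hj]
    have e2 : (fun j => (Function.update (fun j => (x j, y j)) i (a, b) j).2) =
        Function.update y i b := by
      funext j; by_cases hj : j = i
      · subst hj; simp
      · simp [hj]
    rw [MultiLOCC.pair, e1, e2]
    ring
  funext ⟨a, b⟩
  exact congrFun (hχ i (fun b => v (a, b)) fun y => h1 y a) b

/-- A left null vector of a singular factor would contract the image `χ` to zero. This supplies the
invertibility demanded by the stabilizer, as Kraus operators are not assumed invertible. -/
theorem HasFullLocalRank.isUnit_of_mulVec [DecidableEq α] {φ χ : (Fin n → α) → ℂ}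
    (hχ : HasFullLocalRank χ) {A : Fin n → Matrix α α ℂ} (h : localOp A *ᵥ φ = χ) (i : Fin n) :
    IsUnit (A i) := by
  rw [Matrix.isUnit_iff_isUnit_det, isUnit_iff_ne_zero]
  intro hdet
  obtain ⟨v, hv, hvA⟩ := Matrix.exists_vecMul_eq_zero_iff.mpr hdet
  refine hv (hχ i v fun x => ?_)
  have hvA' : ∀ b, ∑ a, v a * A i a b = 0 := fun b => congrFun hvA b
  simp only [← h, Matrix.mulVec, dotProduct, localOp_apply, Finset.mul_sum]
  rw [Finset.sum_comm]
  refine Finset.sum_eq_zero fun z _ => ?_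
  have hprod : ∀ a, ∏ j, A j (Function.update x i a j) (z j) =
      A i a (z i) * ∏ j ∈ Finset.univ.erase i, A j (x j) (z j) := by
    intro a
    rw [← Finset.mul_prod_erase Finset.univ _ (Finset.mem_univ i), Function.update_self]
    congr 1
    refine Finset.prod_congr rfl fun j hj => ?_
    rw [Function.update_of_ne (Finset.ne_of_mem_erase hj)]
  simp only [hprod]
  calc ∑ a, v a * (A i a (z i) * (∏ j ∈ Finset.univ.erase i, A j (x j) (z j)) * φ z)
      = (∑ a, v a * A i a (z i)) * ((∏ j ∈ Finset.univ.erase i, A j (x j) (z j)) * φ z) := by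
        rw [Finset.sum_mul]
        exact Finset.sum_congr rfl fun a _ => by ring
    _ = 0 := by rw [hvA', zero_mul]

end FullLocalRank

/-! ### Operators on two copies -/

section Pairs

variable {n d : ℕ}

/-- The operator `P ⊗ Q` on two copies. -/
def pairOp (P Q : Matrix (Fin n → Fin d) (Fin n → Fin d) ℂ) :
    Matrix (Fin n → Fin d × Fin d) (Fin n → Fin d × Fin d) ℂ :=
  Matrix.of fun y x =>
    P (fun i => (y i).1) (fun i => (x i).1) * Q (fun i => (y i).2) (fun i => (x i).2)

theorem sum_pair {M : Type} [AddCommMonoid M] (f : (Fin n → Fin d × Fin d) → M) :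
    ∑ x, f x = ∑ s : Fin n → Fin d, ∑ t : Fin n → Fin d, f fun i => (s i, t i) := by
  rw [← (Equiv.arrowProdEquivProdArrow (Fin n) (fun _ => Fin d) fun _ => Fin d).symm.sum_comp,
    Fintype.sum_prod_type]
  rfl

theorem pairOp_mulVec (P Q : Matrix (Fin n → Fin d) (Fin n → Fin d) ℂ) (a b : (Fin n → Fin d) → ℂ) :
    pairOp P Q *ᵥ pair a b = pair (P *ᵥ a) (Q *ᵥ b) := by
  funext y
  simp only [Matrix.mulVec, dotProduct, pairOp, pair, Matrix.of_apply, sum_pair, Finset.sum_mul_sum]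
  refine Finset.sum_congr rfl fun s _ => Finset.sum_congr rfl fun t _ => ?_
  ring

theorem pairOp_conjTranspose (P Q : Matrix (Fin n → Fin d) (Fin n → Fin d) ℂ) :
    (pairOp P Q)ᴴ = pairOp Pᴴ Qᴴ := by
  ext y x
  simp [pairOp, Matrix.conjTranspose_apply]

theorem localOp_kronecker (A B : Fin n → Matrix (Fin d) (Fin d) ℂ) :
    localOp (fun i => Matrix.kroneckerMap (· * ·) (A i) (B i)) = pairOp (localOp A) (localOp B) := by
  ext y x
  simp [pairOp, Finset.prod_mul_distrib]

theorem swapOp_apply (y x : Fin n → Fin d × Fin d) :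
    swapOp n d y x = if y = fun i => (x i).swap then 1 else 0 := by
  simp only [swapOp, localOp_apply, Matrix.of_apply]
  by_cases h : y = fun i => (x i).swap
  · rw [if_pos h]
    exact Finset.prod_eq_one fun i _ => if_pos (congrFun h i)
  · rw [if_neg h]
    obtain ⟨i, hi⟩ := Function.ne_iff.mp h
    exact Finset.prod_eq_zero (Finset.mem_univ i) (if_neg hi)

theorem swapOp_conjTranspose : (swapOp n d)ᴴ = swapOp n d := by
  rw [swapOp, localOp_conjTranspose]
  congr 1
  funext i
  ext y x
  simp only [Matrix.conjTranspose_apply, Matrix.of_apply]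
  by_cases h : y = x.swap
  · subst h; simp
  · rw [if_neg h, if_neg fun h' => h (by rw [h', Prod.swap_swap]), star_zero]

theorem swapOp_mulVec_pair (a b : (Fin n → Fin d) → ℂ) : swapOp n d *ᵥ pair a b = pair b a := by
  funext y
  have h : ∀ x, swapOp n d y x = if x = fun i => (y i).swap then 1 else 0 := by
    intro x
    rw [swapOp_apply]
    refine if_congr ⟨?_, ?_⟩ rfl rfl <;> rintro rfl <;> simp
  simp only [Matrix.mulVec, dotProduct, h, ite_mul, one_mul, zero_mul, Finset.sum_ite_eq',
    Finset.mem_univ, if_true]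
  simp [pair, mul_comm]

theorem pair_ne_zero {a b : (Fin n → Fin d) → ℂ} (ha : a ≠ 0) (hb : b ≠ 0) : pair a b ≠ 0 := by
  obtain ⟨s, hs⟩ := Function.ne_iff.mp ha
  obtain ⟨t, ht⟩ := Function.ne_iff.mp hb
  exact Function.ne_iff.mpr ⟨fun i => (s i, t i), mul_ne_zero hs ht⟩

/-- The local invertible operator `⨂ i, A i ⊗ B i`. -/
def pairGL (A B : Fin n → GL (Fin d) ℂ) (i : Fin n) : GL (Fin d × Fin d) ℂ where
  val := Matrix.kroneckerMap (· * ·) (A i : Matrix (Fin d) (Fin d) ℂ) (B i)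
  inv := Matrix.kroneckerMap (· * ·) ((A i)⁻¹ : GL (Fin d) ℂ).val ((B i)⁻¹ : GL (Fin d) ℂ).val
  val_inv := by
    rw [← Matrix.mul_kronecker_mul]
    simp [-Matrix.coe_units_inv]
  inv_val := by
    rw [← Matrix.mul_kronecker_mul]
    simp [-Matrix.coe_units_inv]

theorem localOp_pairGL (A B : Fin n → GL (Fin d) ℂ) :
    localOp (fun i => (pairGL A B i : Matrix (Fin d × Fin d) (Fin d × Fin d) ℂ)) =
      pairOp (localOp fun i => (A i).val) (localOp fun i => (B i).val) :=
  localOp_kronecker _ _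

theorem localOp_inv_mul {α : Type} [Fintype α] [DecidableEq α] (A : Fin n → GL α ℂ) :
    localOp (fun i => ((A i)⁻¹ : GL α ℂ).val) * localOp (fun i => (A i).val) =
      (1 : Matrix (Fin n → α) (Fin n → α) ℂ) := by
  rw [localOp_mul]
  simp only [← Units.val_mul, inv_mul_cancel, Units.val_one]
  exact localOp_one

theorem localOp_mul_inv {α : Type} [Fintype α] [DecidableEq α] (A : Fin n → GL α ℂ) :
    localOp (fun i => (A i).val) * localOp (fun i => ((A i)⁻¹ : GL α ℂ).val) =
      (1 : Matrix (Fin n → α) (Fin n → α) ℂ) := by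
  rw [localOp_mul]
  simp only [← Units.val_mul, mul_inv_cancel, Units.val_one]
  exact localOp_one

end Pairs

/-! ### Consequences of a trivial stabilizer -/

section Stabilizer

variable {n d : ℕ} {ψ : (Fin n → Fin d) → ℂ}

/-- A local operator of which `ψ ⊗ ψ` is an eigenvector with nonzero eigenvalue is a multiple of the
identity or of the swap. -/
theorem localOp_eq_smul_of_mulVec_pair (hψ : ψ ≠ 0) (hrank : HasFullLocalRank (pair ψ ψ))
    (hstab : stabilizer (pair ψ ψ) = {1, swapOp n d})
    {B : Fin n → Matrix (Fin d × Fin d) (Fin d × Fin d) ℂ} {c : ℂ} (hc : c ≠ 0)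
    (h : localOp B *ᵥ pair ψ ψ = c • pair ψ ψ) : localOp B = c • 1 ∨ localOp B = c • swapOp n d := by
  -- The scalar `c⁻¹` is given to the first party. Without parties nothing can carry it, but then
  -- `localOp B = 1` and `c = 1`.
  obtain ⟨s, hs⟩ : ∃ s : Fin n → ℂ, localOp (fun i => s i • B i) = c⁻¹ • localOp B := by
    cases n with
    | zero =>
      have hB : localOp B = 1 := by
        rw [← localOp_one]
        congr 1
        exact Subsingleton.elim _ _
      have hc1 : c = 1 := by
        rw [hB, Matrix.one_mulVec] at h
        have h2 : (1 - c) • pair ψ ψ = 0 := by rw [sub_smul, one_smul, ← h, sub_self]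
        have h3 := (smul_eq_zero.mp h2).resolve_right (pair_ne_zero hψ hψ)
        exact (sub_eq_zero.mp h3).symm
      exact ⟨fun _ => 1, by simp [hc1]⟩
    | succ n =>
      refine ⟨Fin.cons c⁻¹ fun _ => 1, ?_⟩
      rw [localOp_smul, Fin.prod_univ_succ]
      simp
  have hfix : localOp (fun i => s i • B i) *ᵥ pair ψ ψ = pair ψ ψ := by
    rw [hs, Matrix.smul_mulVec, h, smul_smul, inv_mul_cancel₀ hc, one_smul]
  have hmem : localOp (fun i => s i • B i) ∈ stabilizer (pair ψ ψ) :=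
    ⟨⟨fun i => (hrank.isUnit_of_mulVec hfix i).unit, rfl⟩, hfix⟩
  have hB : localOp B = c • localOp (fun i => s i • B i) := by
    rw [hs, smul_smul, mul_inv_cancel₀ hc, one_smul]
  rw [hstab] at hmem
  rcases hmem with h1 | h1
  · left; rw [hB, h1]
  · right; rw [hB, h1]

/-- A local invertible operator of which `ψ` is an eigenvector is a multiple of the identity. -/
theorem localOp_eq_smul_one_of_mulVec (hψ : ψ ≠ 0)
    (hstab : stabilizer (pair ψ ψ) = {1, swapOp n d}) {S : Fin n → GL (Fin d) ℂ} {c : ℂ} (hc : c ≠ 0)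
    (h : localOp (fun i => (S i).val) *ᵥ ψ = c • ψ) :
    ∃ μ : ℂ, localOp (fun i => (S i).val) = μ • (1 : Matrix (Fin n → Fin d) (Fin n → Fin d) ℂ) := by
  set T := localOp fun i => (S i).val with hT
  set T' := localOp fun i => ((S i)⁻¹ : GL (Fin d) ℂ).val with hT'
  have hinv : T' *ᵥ ψ = c⁻¹ • ψ := by
    have h1 := congrArg (T' *ᵥ ·) h
    simp only [Matrix.mulVec_mulVec, Matrix.mulVec_smul] at h1
    rw [hT', hT, localOp_inv_mul, Matrix.one_mulVec, ← hT'] at h1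
    rw [eq_comm, inv_smul_eq_iff₀ hc]
    exact h1
  -- In `T ⊗ T⁻¹` the eigenvalues `c` and `c⁻¹` cancel.
  have hmem : pairOp T T' ∈ stabilizer (pair ψ ψ) := by
    refine ⟨⟨pairGL S fun i => (S i)⁻¹, (localOp_pairGL _ _).symm⟩, ?_⟩
    rw [pairOp_mulVec, h, hinv]
    funext x
    simp only [pair, Pi.smul_apply, smul_eq_mul]
    field_simp
  rw [hstab] at hmem
  obtain ⟨x₀, -⟩ := Function.ne_iff.mp hψ
  rcases hmem with h1 | h1
  · have hentry : ∀ s t u v, T s u * T' t v = if s = u ∧ t = v then 1 else 0 := by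
      intro s t u v
      have h2 := congrFun (congrFun h1 fun i => (s i, t i)) fun i => (u i, v i)
      simp only [pairOp, Matrix.of_apply, Matrix.one_apply] at h2
      rw [h2]
      refine if_congr ?_ rfl rfl
      simp only [funext_iff, Prod.mk.injEq, forall_and]
    have h0 : T x₀ x₀ * T' x₀ x₀ = 1 := by simpa using hentry x₀ x₀ x₀ x₀
    have hT0 : T' x₀ x₀ ≠ 0 := right_ne_zero_of_mul_eq_one h0
    refine ⟨(T' x₀ x₀)⁻¹, ?_⟩
    ext s u
    rw [eq_comm, Matrix.smul_apply, smul_eq_mul, inv_mul_eq_iff_eq_mul₀ hT0, mul_comm, hentry,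
      Matrix.one_apply]
    simp
  · have hentry : ∀ s t u v, T s u * T' t v = if s = v ∧ t = u then 1 else 0 := by
      intro s t u v
      have h2 := congrFun (congrFun (Set.mem_singleton_iff.mp h1) fun i => (s i, t i))
        fun i => (u i, v i)
      rw [swapOp_apply] at h2
      simp only [pairOp, Matrix.of_apply] at h2
      rw [h2]
      refine if_congr ?_ rfl rfl
      simp only [funext_iff, Prod.swap_prod_mk, Prod.mk.injEq, forall_and]
    -- The swap is a product across the two copies only if the space of one copy is one-dimensional,
    -- and there every operator is scalar.
    have hsub : ∀ s u : Fin n → Fin d, s = u := by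
      intro s u
      by_contra hne
      have h2 := hentry s u u s
      have h3 := hentry s s s s
      have h4 := hentry s s u s
      rw [if_pos ⟨rfl, rfl⟩] at h2 h3
      rw [if_neg fun h => hne h.2] at h4
      rcases mul_eq_zero.mp h4 with h5 | h5
      · rw [h5, zero_mul] at h2; exact zero_ne_one h2
      · rw [h5, mul_zero] at h3; exact zero_ne_one h3
    refine ⟨T x₀ x₀, ?_⟩
    ext s u
    rw [hsub s x₀, hsub u x₀]
    simp

end Stabilizer

/-! ### Local unitary equivalence -/

section LocalUnitary

variable {n d : ℕ}

theorem stateOf_smul {ι : Type} [Fintype ι] {c : ℂ} (hc : c ≠ 0) (a : ι → ℂ) :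
    stateOf (c • a) = stateOf a := by
  have hc' : star c ≠ 0 := star_ne_zero.mpr hc
  simp only [stateOf, star_smul, smul_dotProduct, dotProduct_smul, smul_vecMulVec, vecMulVec_smul,
    smul_smul, smul_eq_mul]
  congr 1
  rw [mul_inv, mul_inv]
  field_simp

/-- Freezing all other parties at the basis vector `x₀` exhibits `C i`, times a constant, as a block
of a scalar matrix. -/
theorem exists_smul_one_of_localOp_eq {C : Fin n → Matrix (Fin d) (Fin d) ℂ} {c : ℂ} (hc : c ≠ 0)
    (x₀ : Fin n → Fin d)
    (h : localOp C = c • (1 : Matrix (Fin n → Fin d) (Fin n → Fin d) ℂ)) (i : Fin n) :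
    ∃ k : ℂ, k ≠ 0 ∧ C i = k • 1 := by
  have hentry : ∀ a b, C i a b * ∏ j ∈ Finset.univ.erase i, C j (x₀ j) (x₀ j) =
      if a = b then c else 0 := by
    intro a b
    have h1 := congrFun (congrFun h (Function.update x₀ i a)) (Function.update x₀ i b)
    rw [localOp_apply, ← Finset.mul_prod_erase Finset.univ _ (Finset.mem_univ i), Function.update_self,
      Function.update_self] at h1
    rw [Finset.prod_congr rfl fun j hj => by
      rw [Function.update_of_ne (Finset.ne_of_mem_erase hj),
        Function.update_of_ne (Finset.ne_of_mem_erase hj)]] at h1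
    rw [h1, Matrix.smul_apply, Matrix.one_apply, smul_eq_mul, mul_ite, mul_one, mul_zero]
    refine if_congr ⟨fun h => ?_, fun h => by rw [h]⟩ rfl rfl
    simpa using congrFun h i
  set p := ∏ j ∈ Finset.univ.erase i, C j (x₀ j) (x₀ j)
  have hp : p ≠ 0 := by
    have := hentry (x₀ i) (x₀ i)
    rw [if_pos rfl] at this
    exact right_ne_zero_of_mul (this ▸ hc)
  refine ⟨c / p, div_ne_zero hc hp, ?_⟩
  ext a b
  rw [Matrix.smul_apply, Matrix.one_apply, smul_eq_mul, mul_ite, mul_one, mul_zero]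
  have := hentry a b
  split_ifs at this ⊢ with hab
  · rw [eq_div_iff hp, this]
  · exact (mul_eq_zero.mp this).resolve_right hp

/-- The scalar `k` is the squared norm of column `a`, hence real and positive, and `W` is rescaled
by `1 / √k`. -/
theorem exists_unitary_of_conjTranspose_mul_eq {W : Matrix (Fin d) (Fin d) ℂ} (a : Fin d) {k : ℂ}
    (hk : k ≠ 0) (h : Wᴴ * W = k • 1) :
    ∃ (s : ℂ) (u : Matrix.unitaryGroup (Fin d) ℂ), s ≠ 0 ∧ (u : Matrix (Fin d) (Fin d) ℂ) = s • W := by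
  set r : ℝ := ∑ b, ‖W b a‖ ^ 2
  have hkr : k = r := by
    have h1 := congrFun (congrFun h a) a
    simp only [Matrix.mul_apply, Matrix.conjTranspose_apply, Matrix.smul_apply, Matrix.one_apply_eq,
      smul_eq_mul, mul_one] at h1
    rw [← h1, Complex.ofReal_sum]
    refine Finset.sum_congr rfl fun b _ => ?_
    rw [Complex.star_def, Complex.conj_mul']
    push_cast
    rfl
  have hr0 : 0 ≤ r := by positivity
  have hr : r ≠ 0 := by
    rintro h0
    exact hk (by rw [hkr, h0, Complex.ofReal_zero])
  refine ⟨(((√r)⁻¹ : ℝ) : ℂ), ⟨(((√r)⁻¹ : ℝ) : ℂ) • W, ?_⟩, ?_, rfl⟩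
  · rw [Matrix.mem_unitaryGroup_iff', Matrix.star_eq_conjTranspose, Matrix.conjTranspose_smul,
      Matrix.smul_mul, Matrix.mul_smul, h, hkr, smul_smul, smul_smul, Complex.star_def,
      Complex.conj_ofReal, ← Complex.ofReal_mul, ← Complex.ofReal_mul, ← mul_inv,
      Real.mul_self_sqrt hr0, inv_mul_cancel₀ hr, Complex.ofReal_one, one_smul]
  · rw [Complex.ofReal_ne_zero]
    exact inv_ne_zero ((Real.sqrt_ne_zero hr0).mpr hr)

theorem luEquivalent_of_isProportional {ψ : (Fin n → Fin d) → ℂ} (hψ : ψ ≠ 0)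
    (hstab : stabilizer (pair ψ ψ) = {1, swapOp n d}) {g h : Fin n → GL (Fin d) ℂ}
    (hgh : IsProportional ((localOp fun i => (g i).val)ᴴ *ᵥ act g ψ)
      ((localOp fun i => (h i).val)ᴴ *ᵥ act h ψ)) :
    LUEquivalent (act g ψ) (act h ψ) := by
  obtain ⟨x₀, -⟩ := Function.ne_iff.mp hψ
  obtain ⟨c, hc, hgh⟩ := hgh.symm
  set W : Fin n → GL (Fin d) ℂ := fun i => h i * (g i)⁻¹ with hW
  -- the Gram operators of `g` and `h` agree up to a scalar
  have hstar : ∀ k : Fin n → GL (Fin d) ℂ, (localOp fun i => (star (k i)).val) =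
      (localOp fun i => (k i).val)ᴴ := by
    intro k
    rw [localOp_conjTranspose]
    rfl
  set S : Fin n → GL (Fin d) ℂ := fun i => (star (g i) * g i)⁻¹ * (star (h i) * h i) with hS
  have hSloc : localOp (fun i => (S i).val) = localOp (fun i => ((star (g i) * g i)⁻¹ : GL (Fin d) ℂ).val) *
      ((localOp fun i => (h i).val)ᴴ * localOp fun i => (h i).val) := by
    rw [← hstar, localOp_mul, localOp_mul]
    rfl
  have hgg : (localOp fun i => (g i).val)ᴴ * (localOp fun i => (g i).val) =
      localOp fun i => (star (g i) * g i).val := by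
    rw [← hstar, localOp_mul]
    rfl
  have hSψ : localOp (fun i => (S i).val) *ᵥ ψ = c • ψ := by
    rw [hSloc, ← Matrix.mulVec_mulVec, ← Matrix.mulVec_mulVec]
    change _ *ᵥ ((localOp fun i => (h i).val)ᴴ *ᵥ act h ψ) = _
    rw [hgh, act, Matrix.mulVec_mulVec, hgg, Matrix.mulVec_smul, Matrix.mulVec_mulVec,
      localOp_inv_mul fun i => star (g i) * g i, Matrix.one_mulVec]
  obtain ⟨μ, hμ⟩ := localOp_eq_smul_one_of_mulVec hψ hstab hc hSψ
  have hμ0 : μ ≠ 0 := by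
    rintro rfl
    rw [zero_smul] at hμ
    rw [hμ, Matrix.zero_mulVec] at hSψ
    exact (smul_ne_zero hc hψ) hSψ.symm
  -- Since `hᴴh = gᴴg S`, conjugation by `g⁻¹` turns the scalar operator `S` into `Wᴴ W = μ`.
  have hWW : localOp (fun i => ((W i).val)ᴴ * (W i).val) =
      μ • (1 : Matrix (Fin n → Fin d) (Fin n → Fin d) ℂ) := by
    have h1 : ∀ i, ((W i).val)ᴴ * (W i).val =
        (star ((g i)⁻¹)).val * ((star (g i) * g i).val * (S i).val) * ((g i)⁻¹ : GL (Fin d) ℂ).val := by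
      intro i
      change (star (W i) * W i).val =
        (star ((g i)⁻¹) * ((star (g i) * g i) * S i) * (g i)⁻¹).val
      rw [hS, hW]
      congr 1
      simp only [star_mul]
      group
    simp only [h1]
    have h2 := localOp_mul (fun i => (star ((g i)⁻¹)).val * ((star (g i) * g i).val * (S i).val))
      (fun i => ((g i)⁻¹ : GL (Fin d) ℂ).val)
    have h3 := localOp_mul (fun i => (star ((g i)⁻¹)).val)
      (fun i => (star (g i) * g i).val * (S i).val)
    have h4 := localOp_mul (fun i => (star (g i) * g i).val) (fun i => (S i).val)
    rw [← h2, ← h3, ← h4, hμ, Matrix.mul_smul, Matrix.mul_one, Matrix.mul_smul, Matrix.smul_mul,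
      localOp_mul, localOp_mul, ← localOp_one]
    congr 2
    funext i
    change (star ((g i)⁻¹) * (star (g i) * g i) * (g i)⁻¹).val = 1
    rw [← mul_assoc, ← star_mul, mul_inv_cancel, star_one, one_mul, mul_inv_cancel, Units.val_one]
  choose k hk hkW using exists_smul_one_of_localOp_eq hμ0 x₀ hWW
  choose s u hs hu using fun i => exists_unitary_of_conjTranspose_mul_eq (x₀ i) (hk i) (hkW i)
  refine ⟨u, ?_⟩
  have hWact : localOp (fun i => (W i).val) *ᵥ act g ψ = act h ψ := by
    rw [act, act, Matrix.mulVec_mulVec, localOp_mul]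
    congr 2
    funext i
    change (h i * (g i)⁻¹ * g i).val = _
    rw [inv_mul_cancel_right]
  simp only [hu]
  rw [localOp_smul, Matrix.smul_mulVec, hWact, stateOf_smul (Finset.prod_ne_zero_iff.mpr fun i _ => hs i)]

end LocalUnitary

/-! ### Separable transformations of two copies -/

section Transformations

variable {n d : ℕ} {ψ : (Fin n → Fin d) → ℂ}

theorem act_ne_zero (hψ : ψ ≠ 0) (g : Fin n → GL (Fin d) ℂ) : act g ψ ≠ 0 := by
  intro h
  apply hψ
  rw [← Matrix.one_mulVec ψ, ← localOp_inv_mul g, ← Matrix.mulVec_mulVec]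
  change _ *ᵥ act g ψ = 0
  rw [h, Matrix.mulVec_zero]

theorem conjTranspose_mulVec_act_ne_zero (hψ : ψ ≠ 0) (g : Fin n → GL (Fin d) ℂ) :
    (localOp fun i => (g i).val)ᴴ *ᵥ act g ψ ≠ 0 := by
  have h : (localOp fun i => (g i).val)ᴴ = localOp fun i => (star (g i)).val := by
    rw [localOp_conjTranspose]
    rfl
  rw [h]
  exact act_ne_zero (act_ne_zero hψ g) fun i => star (g i)

/-- Kraus operators, proportional to product operators, that send `g₁ψ ⊗ g₂ψ` to multiples of
`h₁ψ ⊗ h₂ψ`. -/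
theorem conjTranspose_mulVec_mem_span (hψ : ψ ≠ 0) (hrank : HasFullLocalRank (pair ψ ψ))
    (hstab : stabilizer (pair ψ ψ) = {1, swapOp n d}) (g₁ g₂ h₁ h₂ : Fin n → GL (Fin d) ℂ)
    {s c : ℂ} {K : Fin n → Matrix (Fin d × Fin d) (Fin d × Fin d) ℂ}
    (h : (s • localOp K) *ᵥ pair (act g₁ ψ) (act g₂ ψ) = c • pair (act h₁ ψ) (act h₂ ψ)) :
    (pairOp (localOp fun i => (g₁ i).val) (localOp fun i => (g₂ i).val))ᴴ *ᵥ
        ((s • localOp K)ᴴ *ᵥ ((s • localOp K) *ᵥ pair (act g₁ ψ) (act g₂ ψ))) ∈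
      Submodule.span ℂ
        {pair ((localOp fun i => (h₁ i).val)ᴴ *ᵥ act h₁ ψ) ((localOp fun i => (h₂ i).val)ᴴ *ᵥ act h₂ ψ),
         pair ((localOp fun i => (h₂ i).val)ᴴ *ᵥ act h₂ ψ) ((localOp fun i => (h₁ i).val)ᴴ *ᵥ act h₁ ψ)} := by
  -- A Kraus operator that kills the input contributes nothing to the sum, so its form need not be
  -- known.
  by_cases hc : c = 0
  · rw [h, hc, zero_smul, Matrix.mulVec_zero, Matrix.mulVec_zero]
    exact Submodule.zero_mem _
  have hact : ∀ k₁ k₂ : Fin n → GL (Fin d) ℂ, pair (act k₁ ψ) (act k₂ ψ) =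
      localOp (fun i => (pairGL k₁ k₂ i).val) *ᵥ pair ψ ψ := by
    intro k₁ k₂
    rw [localOp_pairGL, pairOp_mulVec]
    rfl
  set P := localOp fun i => (pairGL h₁ h₂ i).val with hP
  set P' := localOp fun i => ((pairGL h₁ h₂ i)⁻¹ : GL (Fin d × Fin d) ℂ).val with hP'
  set Q := localOp fun i => (pairGL g₁ g₂ i).val with hQ
  set Q' := localOp fun i => ((pairGL g₁ g₂ i)⁻¹ : GL (Fin d × Fin d) ℂ).val with hQ'
  have hPP : P' * P = 1 := localOp_inv_mul _
  have hPP' : P * P' = 1 := localOp_mul_inv _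
  have hQQ : Q * Q' = 1 := localOp_mul_inv _
  have hs : s ≠ 0 := by
    rintro rfl
    rw [zero_smul, Matrix.zero_mulVec] at h
    exact smul_ne_zero hc (pair_ne_zero (act_ne_zero hψ h₁) (act_ne_zero hψ h₂)) h.symm
  have hB : localOp (fun i => ((pairGL h₁ h₂ i)⁻¹ : GL (Fin d × Fin d) ℂ).val * K i *
      (pairGL g₁ g₂ i).val) = P' * localOp K * Q := by
    rw [hP', hQ, localOp_mul, localOp_mul]
  have hBψ : localOp (fun i => ((pairGL h₁ h₂ i)⁻¹ : GL (Fin d × Fin d) ℂ).val * K i *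
      (pairGL g₁ g₂ i).val) *ᵥ pair ψ ψ = (s⁻¹ * c) • pair ψ ψ := by
    have h1 := congrArg (fun v => s⁻¹ • (P' *ᵥ v)) h
    simp only [hact] at h1
    rw [Matrix.smul_mulVec, Matrix.mulVec_smul, Matrix.mulVec_smul, smul_smul, smul_smul,
      inv_mul_cancel₀ hs, one_smul] at h1
    simp only [Matrix.mulVec_mulVec] at h1
    rw [hB, Matrix.mul_assoc]
    rw [hPP, Matrix.one_mulVec] at h1
    exact h1
  obtain ⟨S, hS, hBS⟩ : ∃ S, (S = 1 ∨ S = swapOp n d) ∧ P' * localOp K * Q = (s⁻¹ * c) • S := by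
    rw [← hB]
    rcases localOp_eq_smul_of_mulVec_pair hψ hrank hstab
      (mul_ne_zero (inv_ne_zero hs) hc) hBψ with h1 | h1
    · exact ⟨1, Or.inl rfl, h1⟩
    · exact ⟨_, Or.inr rfl, h1⟩
  have hKQ : (s • localOp K) * Q = c • (P * S) := by
    have h1 : P * (P' * localOp K * Q) = localOp K * Q := by
      rw [← Matrix.mul_assoc, ← Matrix.mul_assoc, hPP', Matrix.one_mul]
    rw [Matrix.smul_mul, ← h1, hBS, Matrix.mul_smul, smul_smul, mul_inv_cancel_left₀ hs]
  have hQdef : pairOp (localOp fun i => (g₁ i).val) (localOp fun i => (g₂ i).val) = Q :=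
    (localOp_pairGL _ _).symm
  have hSh : Sᴴ = S := by
    rcases hS with rfl | rfl
    · exact Matrix.conjTranspose_one
    · exact swapOp_conjTranspose
  -- The adjoint of `KQ = c P S` sends `c P(ψ ⊗ ψ)` to `|c|² S Pᴴ P(ψ ⊗ ψ)`; here `S` keeps or
  -- exchanges the two factors.
  rw [h, hQdef, Matrix.mulVec_mulVec, ← Matrix.conjTranspose_mul, hKQ, Matrix.conjTranspose_smul,
    Matrix.conjTranspose_mul, Matrix.mulVec_smul, Matrix.smul_mulVec, hSh, ← Matrix.mulVec_mulVec]
  refine Submodule.smul_mem _ _ (Submodule.smul_mem _ _ (Submodule.subset_span ?_))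
  rw [hP, localOp_pairGL, pairOp_conjTranspose, pairOp_mulVec]
  rcases hS with rfl | rfl
  · left; rw [Matrix.one_mulVec]
  · right; rw [swapOp_mulVec_pair]; rfl

theorem trivialTransformation_of_isSeparableChannel (hψ : ψ ≠ 0) (hfull : FullyEntangled ψ)
    (hstab : stabilizer (pair ψ ψ) = {1, swapOp n d}) (g₁ g₂ h₁ h₂ : Fin n → GL (Fin d) ℂ)
    {Λ : OpMap (Fin n → Fin d × Fin d) (Fin n → Fin d × Fin d)}
    (hΛ : IsSeparableChannel (α := fun _ => Fin d × Fin d) (β := fun _ => Fin d × Fin d) Λ)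
    (hmap : Λ (stateOf (pair (act g₁ ψ) (act g₂ ψ))) = stateOf (pair (act h₁ ψ) (act h₂ ψ))) :
    TrivialTransformation (act g₁ ψ) (act g₂ ψ) (act h₁ ψ) (act h₂ ψ) := by
  have hrank := hfull.hasFullLocalRank.pair hfull.hasFullLocalRank
  obtain ⟨x₀, -⟩ := Function.ne_iff.mp hψ
  have hne : ∀ _ : Fin n, Nonempty (Fin d × Fin d) := fun i => ⟨(x₀ i, x₀ i)⟩
  obtain ⟨L, _, s, K, hK⟩ := @exists_kraus_of_mem_closedSepCone n (fun _ => Fin d × Fin d)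
    (fun _ => Fin d × Fin d) _ _ hne hne Λ hΛ.1
  set a := pair (act g₁ ψ) (act g₂ ψ) with ha
  set b := pair (act h₁ ψ) (act h₂ ψ) with hb
  have ha0 : a ≠ 0 := pair_ne_zero (act_ne_zero hψ g₁) (act_ne_zero hψ g₂)
  have hb0 : b ≠ 0 := pair_ne_zero (act_ne_zero hψ h₁) (act_ne_zero hψ h₂)
  have haa : star a ⬝ᵥ a ≠ 0 := by
    open scoped ComplexOrder in exact fun h => ha0 (dotProduct_star_self_eq_zero.mp h)
  have hsum : ∑ l, vecMulVec ((s l • localOp (K l)) *ᵥ a) (star ((s l • localOp (K l)) *ᵥ a)) =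
      ((star a ⬝ᵥ a) * (star b ⬝ᵥ b)⁻¹) • vecMulVec b (star b) := by
    have h1 : Λ (vecMulVec a (star a)) = (star a ⬝ᵥ a) • stateOf b := by
      rw [← hmap, stateOf, map_smul, smul_smul, mul_inv_cancel₀ haa, one_smul]
    rw [hK, stateOf, smul_smul] at h1
    rw [← h1]
    refine Finset.sum_congr rfl fun l _ => ?_
    rw [conjMap, Matrix.mul_vecMulVec, Matrix.vecMulVec_mul, ← Matrix.star_mulVec]
  choose c hc using exists_smul_of_sum_vecMulVec _ hb0 hsum
  -- Completeness is needed at the input vector alone: it writes `a` as the sum of the `Kᴴ K a`,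
  -- each of which the adjoint of `g₁ ⊗ g₂` sends into the span of the two orderings.
  have hid := sum_conjTranspose_mul_mulVec (fun l => s l • localOp (K l))
    (fun v => by rw [← hK]; exact hΛ.2 v) a
  have hspan := Submodule.sum_mem _ fun l (_ : l ∈ Finset.univ) =>
    conjTranspose_mulVec_mem_span hψ hrank hstab g₁ g₂ h₁ h₂ (hc l)
  rw [← Matrix.mulVec_sum, hid, pairOp_conjTranspose, ha, pairOp_mulVec,
    Submodule.mem_span_pair] at hspan
  obtain ⟨p, q, hpq⟩ := hspan
  have hprod := isProportional_of_mul_eq_add (conjTranspose_mulVec_act_ne_zero hψ g₁)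
    (conjTranspose_mulVec_act_ne_zero hψ g₂) (p := p) (q := q) fun u v =>
      (congrFun hpq fun i => (u i, v i)).symm
  exact hprod.imp
    (fun h => ⟨luEquivalent_of_isProportional hψ hstab h.1, luEquivalent_of_isProportional hψ hstab h.2⟩)
    (fun h => ⟨luEquivalent_of_isProportional hψ hstab h.1, luEquivalent_of_isProportional hψ hstab h.2⟩)

end Transformations

end MultiLOCC

theorem theorem2 {n d : ℕ} (ψ : (Fin n → Fin d) → ℂ) (hψ : ψ ≠ 0)
    (hfull : FullyEntangled ψ)
    (hstab : MultiLOCC.stabilizer (pair ψ ψ) = {1, swapOp n d})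
    (g₁ g₂ h₁ h₂ : Fin n → GL (Fin d) ℂ) :
    (TransformsLOCCN (pair (act g₁ ψ) (act g₂ ψ)) (pair (act h₁ ψ) (act h₂ ψ)) →
      TrivialTransformation (act g₁ ψ) (act g₂ ψ) (act h₁ ψ) (act h₂ ψ)) ∧
    (act h₁ ψ = act h₂ ψ →
      TransformsLOCC (pair (act g₁ ψ) (act g₂ ψ)) (pair (act h₁ ψ) (act h₂ ψ)) →
      TrivialTransformation (act g₁ ψ) (act g₂ ψ) (act h₁ ψ) (act h₂ ψ)) := by
  refine ⟨?_, fun _ => ?_⟩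
  · rintro ⟨Λ, hΛ, hmap⟩
    exact trivialTransformation_of_isSeparableChannel hψ hfull hstab g₁ g₂ h₁ h₂
      hΛ.isSeparableChannel hmap
  · rintro ⟨Λ, hΛ, hmap⟩
    exact trivialTransformation_of_isSeparableChannel hψ hfull hstab g₁ g₂ h₁ h₂
      hΛ.isSeparableChannel hmap
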